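/- Let $R\ge 0$ be a random variable with $\mathbb{E}R^2=1$ and $\mathbb{E}R^4<\infty$. For every $d\in\mathbb{N}=\{1,2,\dots\}$ let $R_1,R_2,\dots$ be independent copies of $R$, let $U_1^{(d)},U_2^{(d)},\dots$ be i.i.d. random vectors uniformly distributed on the unit sphere of $\mathbb{R}^d$, and let the sequences $(R_i)_{i\ge1}$ and $(U_i^{(d)})_{i\ge1}$ be independent of each other. Put $$S_k^{(d)}:=\sum_{i=1}^k R_iU_i^{(d)},\qquad k\in\mathbb{N},$$ and let $\|\cdot\|$ be the Euclidean norm. Let $n=n(d)$ be a sequence of positive integers with $n(d)\to\infty$ as $d\to\infty$. Call $R$ deterministic if it is almost surely equal to a constant, and write $\mathrm{N}(0,\sigma^2)$ for the centered normal distribution with variance $\sigma^2$. Then, as $d\to\infty$, the following convergences in distribution hold. (a) If $\lim_{d\to\infty} n/d=0$ and $R$ is not deterministic, then $$\frac{\|S_n^{(d)}\|^2-n}{\sqrt n}\longrightarrow \mathrm{N}(0,\operatorname{Var}(R^2)).$$ (b) If $\lim_{d\to\infty} n/d=\infty$ or $R$ is deterministic, then $$\frac{\|S_n^{(d)}\|^2-n}{\sqrt{2n^2/d}}\longrightarrow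 \mathrm{N}(0,1).$$ (c) If $n\sim\gamma d$ as $d\to\infty$ for some constant $\gamma\in(0,\infty)$, then $$\frac{\|S_n^{(d)}\|^2-n}{\sqrt n}\longrightarrow \mathrm{N}(0,2\gamma+\operatorname{Var}(R^2)).$$ -/

import Mathlib

open MeasureTheory ProbabilityTheory Filter Topology Asymptotics
open scoped ENNReal NNReal

noncomputable section

/-- The uniform distribution on the unit sphere of `ℝ^d` (with its Euclidean norm), as a measure
on `ℝ^d`: the normalized surface measure, pushed forward by the inclusion of the sphere.
For `d = 1` it is the uniform distribution on `{-1, 1}`. -/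
def uniformUnitSphere (d : ℕ) : Measure (EuclideanSpace ℝ (Fin d)) :=
  Measure.map Subtype.val
    (ProbabilityTheory.cond
      (volume : Measure (EuclideanSpace ℝ (Fin d))).toSphere Set.univ)

/-- On the probability space `(Ω, P)`, the variables `R 0, R 1, …` are independent copies of the
random variable `R₀` (which may live on another probability space), `U 0, U 1, …` are i.i.d.
uniformly distributed on the unit sphere of `ℝ^d`, and the two sequences are independent. -/
structure IsRadialDirectional {Ω₀ Ω : Type*} [MeasurableSpace Ω₀] [MeasurableSpace Ω]
    (P₀ : Measure Ω₀) (P : Measure Ω) (d : ℕ) (R₀ : Ω₀ → ℝ)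
    (R : ℕ → Ω → ℝ) (U : ℕ → Ω → EuclideanSpace ℝ (Fin d)) : Prop where
  radial_copy : ∀ i, IdentDistrib (R i) R₀ P P₀
  radial_indep : iIndepFun R P
  direction_law : ∀ i, HasLaw (U i) (uniformUnitSphere d) P
  direction_indep : iIndepFun U P
  radial_indep_direction : IndepFun (fun ω i ↦ R i ω) (fun ω i ↦ U i ω) P

/-- The random walk `S_k = R_1 U_1 + ⋯ + R_k U_k` (the increments are numbered from `0`). -/
def radialWalk {Ω : Type*} {d : ℕ} (R : ℕ → Ω → ℝ) (U : ℕ → Ω → EuclideanSpace ℝ (Fin d))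
    (k : ℕ) (ω : Ω) : EuclideanSpace ℝ (Fin d) :=
  ∑ i ∈ Finset.range k, R i ω • U i ω

/-- A real random variable is called deterministic if it is almost surely equal to a constant. -/
def IsAlmostSurelyConst {Ω : Type*} [MeasurableSpace Ω] (X : Ω → ℝ) (P : Measure Ω) : Prop :=
  ∃ c : ℝ, ∀ᵐ ω ∂P, X ω = c

end

/-! The idea is to realize the directions as `g_i / ‖g_i‖` with `g_i` standard Gaussian and to
compare the walk with the Gaussian sum `∑ R_i g_i / √d`. Expanding the squared norm gives `∑ R_i²`
plus off-diagonal terms. Replacing `⟨U_i, U_j⟩` by `⟨g_i, g_j⟩ / d` costs an error whose terms are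
pairwise orthogonal by sign symmetry and have second moment at most `8 / d²`
(`integral_directionKernel_sq_le`). Adding the Gaussian diagonal costs `∑ R_i² (‖g_i‖² / d - 1)`, of
second moment `2 n E R⁴ / d`.

Given the radii, `∑ R_i g_i` is distributed as `√(∑ R_i²) g`. Replacing `∑ R_i²` by `n` in front of
`‖g‖² / d - 1` costs a further second moment `2 n Var(R²) / d`. What remains is `∑ (R_i² - 1) + n
(‖g‖² / d - 1)`, a sum of two independent parts, each governed by the classical central limit
theorem: the first has variance `n Var(R²)`, the second `2 n² / d`.

All replacements are made at the level of characteristic functions (`norm_charFun_walk_sub_mul_le`),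
where an L² error gives a pointwise bound. The three regimes only differ in which of the two
variances survives the normalization. -/

/-! ### L² bounds for characteristic functions -/

section SecondMoment

variable {Ω : Type*} [MeasurableSpace Ω] {P : Measure Ω}

lemma integral_abs_le_sqrt_integral_sq [IsProbabilityMeasure P] {X : Ω → ℝ} (hX : MemLp X 2 P) :
    ∫ ω, |X ω| ∂P ≤ √(∫ ω, X ω ^ 2 ∂P) := by
  have h := variance_eq_sub hX.abs
  have h0 := variance_nonneg (fun ω ↦ |X ω|) P
  apply Real.le_sqrt_of_sq_le
  have h2 : ∫ ω, (|X ω|) ^ 2 ∂P = ∫ ω, X ω ^ 2 ∂P := by simp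
  change Var[|X|; P] = (∫ ω, |X ω| ^ 2 ∂P) - _ at h
  rw [h2] at h
  change 0 ≤ Var[|X|; P] at h0
  change (∫ ω, |X| ω ∂P) ^ 2 ≤ _
  linarith

/-- The map `x ↦ exp (i t x)` is `|t|`-Lipschitz, and the L¹ norm is at most the L² norm. Every
replacement of one random variable by another goes through this bound. -/
lemma norm_charFun_map_sub_le [IsProbabilityMeasure P] {A B : Ω → ℝ} (hA : AEMeasurable A P)
    (hB : AEMeasurable B P) (hAB : MemLp (fun ω ↦ A ω - B ω) 2 P) (t : ℝ) :
    ‖charFun (P.map A) t - charFun (P.map B) t‖ ≤ |t| * √(∫ ω, (A ω - B ω) ^ 2 ∂P) := by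
  have hint {C : Ω → ℝ} (hC : AEMeasurable C P) :
      Integrable (fun ω ↦ Complex.exp (t * C ω * Complex.I)) P := by
    refine Integrable.of_bound (C := 1) (AEMeasurable.aestronglyMeasurable (by fun_prop)) ?_
    refine ae_of_all _ fun ω ↦ ?_
    rw [← Complex.ofReal_mul, Complex.norm_exp_ofReal_mul_I]
  rw [charFun_apply_real, charFun_apply_real, integral_map hA (by fun_prop),
    integral_map hB (by fun_prop), ← integral_sub (hint hA) (hint hB)]
  have hpt (ω : Ω) : ‖Complex.exp (t * A ω * Complex.I) - Complex.exp (t * B ω * Complex.I)‖ ≤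
      |t| * |A ω - B ω| := by
    have : Complex.exp (t * A ω * Complex.I) - Complex.exp (t * B ω * Complex.I) =
        Complex.exp ((t * B ω : ℝ) * Complex.I) *
          (Complex.exp (Complex.I * (t * (A ω - B ω) : ℝ)) - 1) := by
      rw [mul_sub, ← Complex.exp_add]
      push_cast
      ring_nf
    rw [this, norm_mul, Complex.norm_exp_ofReal_mul_I, one_mul, ← abs_mul]
    exact Real.norm_exp_I_mul_ofReal_sub_one_le
  refine (norm_integral_le_of_norm_le ((hAB.integrable one_le_two).abs.const_mul |t|)
    (ae_of_all _ hpt)).trans ?_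
  rw [integral_const_mul]
  gcongr
  exact integral_abs_le_sqrt_integral_sq hAB

/-- Comparing the variables `s x` and `t x` under `ρ` gives a Lipschitz constant depending only on
the second moment, hence equicontinuity along a family with bounded second moments. -/
lemma norm_charFun_sub_charFun_le {ρ : Measure ℝ} [IsProbabilityMeasure ρ] (hρ : MemLp id 2 ρ)
    (s t : ℝ) : ‖charFun ρ s - charFun ρ t‖ ≤ |s - t| * √(∫ x, x ^ 2 ∂ρ) := by
  have h := norm_charFun_map_sub_le (P := ρ) (A := fun x ↦ s * x) (B := fun x ↦ t * x)
    (by fun_prop) (by fun_prop) (by simpa [← sub_mul] using hρ.const_mul (s - t)) 1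
  rw [charFun_map_mul, charFun_map_mul] at h
  have h2 : ∫ x, (s * x - t * x) ^ 2 ∂ρ = |s - t| ^ 2 * ∫ x, x ^ 2 ∂ρ := by
    rw [← integral_const_mul]
    congr with x
    rw [sq_abs]
    ring
  rw [h2, Real.sqrt_mul (by positivity), Real.sqrt_sq (by positivity)] at h
  simpa using h

lemma integral_sum_sq_of_orthogonal {ι : Type*} (s : Finset ι) {X : ι → Ω → ℝ}
    (hX : ∀ i ∈ s, MemLp (X i) 2 P)
    (h : ∀ i ∈ s, ∀ j ∈ s, i ≠ j → ∫ ω, X i ω * X j ω ∂P = 0) :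
    ∫ ω, (∑ i ∈ s, X i ω) ^ 2 ∂P = ∑ i ∈ s, ∫ ω, X i ω ^ 2 ∂P := by
  simp_rw [sq, Finset.sum_mul_sum]
  have hint {i j : ι} (hi : i ∈ s) (hj : j ∈ s) : Integrable (fun ω ↦ X i ω * X j ω) P :=
    (hX i hi).integrable_mul (hX j hj)
  rw [integral_finsetSum _ fun i hi ↦ integrable_finsetSum _ fun j hj ↦ hint hi hj]
  refine Finset.sum_congr rfl fun i hi ↦ ?_
  rw [integral_finsetSum _ fun j hj ↦ hint hi hj,
    Finset.sum_eq_single_of_mem i hi fun j hj hji ↦ h i hi j hj hji.symm]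

end SecondMoment

/-! ### Moments and central limit theorem for the squared Gaussian norm -/

section GaussianMoments

lemma integral_pow_two_gaussianReal : ∫ x, x ^ 2 ∂(gaussianReal 0 1) = 1 := by
  have h := variance_eq_integral (X := id) (μ := gaussianReal 0 1) aemeasurable_id
  rw [variance_id_gaussianReal] at h
  simpa using h.symm

lemma integral_pow_four_gaussianReal : ∫ x, x ^ 4 ∂(gaussianReal 0 1) = 3 := by
  have h := iteratedDeriv_mgf_zero (X := id) (μ := gaussianReal 0 1)
    (by simp [integrableExpSet_id_gaussianReal]) 4
  -- The fourth moment is read off as the fourth derivative at `0` of the moment generating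
  -- function.
  have e1 (t : ℝ) : HasDerivAt (fun t : ℝ ↦ Real.exp (t ^ 2 / 2)) (t * Real.exp (t ^ 2 / 2)) t := by
    have : HasDerivAt (fun t : ℝ ↦ t ^ 2 / 2) t t := by
      simpa using (hasDerivAt_pow 2 t).div_const 2
    simpa [mul_comm] using this.exp
  have e2 (t : ℝ) : HasDerivAt (fun t : ℝ ↦ t * Real.exp (t ^ 2 / 2))
      ((1 + t ^ 2) * Real.exp (t ^ 2 / 2)) t :=
    ((hasDerivAt_id' t).fun_mul (e1 t)).congr_deriv (by ring)
  have e3 (t : ℝ) : HasDerivAt (fun t : ℝ ↦ (1 + t ^ 2) * Real.exp (t ^ 2 / 2))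
      ((3 * t + t ^ 3) * Real.exp (t ^ 2 / 2)) t :=
    (((hasDerivAt_pow 2 t).const_add 1).fun_mul (e1 t)).congr_deriv (by push_cast; ring)
  have e4 (t : ℝ) : HasDerivAt (fun t : ℝ ↦ (3 * t + t ^ 3) * Real.exp (t ^ 2 / 2))
      ((3 + 6 * t ^ 2 + t ^ 4) * Real.exp (t ^ 2 / 2)) t :=
    ((((hasDerivAt_id' t).const_mul 3).fun_add (hasDerivAt_pow 3 t)).fun_mul (e1 t)).congr_deriv
      (by push_cast; ring)
  rw [mgf_id_gaussianReal] at h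
  simp only [iteratedDeriv_succ, iteratedDeriv_zero, zero_mul, NNReal.coe_one, one_mul, zero_add,
    funext fun t ↦ (e1 t).deriv, funext fun t ↦ (e2 t).deriv, funext fun t ↦ (e3 t).deriv,
    funext fun t ↦ (e4 t).deriv] at h
  simpa using h.symm

lemma memLp_sq_gaussianReal : MemLp (fun x : ℝ ↦ x ^ 2) 2 (gaussianReal 0 1) := by
  have h := (memLp_id_gaussianReal' (μ := 0) (v := 1) 4 (by simp))
  rw [memLp_two_iff_integrable_sq (by fun_prop)]
  have := h.integrable_norm_pow (by norm_num)
  refine this.congr (ae_of_all _ fun x ↦ ?_)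
  simp [← pow_mul, Even.pow_abs (show Even 4 by decide)]

lemma variance_sq_gaussianReal : Var[fun x ↦ x ^ 2; gaussianReal 0 1] = 2 := by
  rw [variance_eq_sub memLp_sq_gaussianReal]
  simp only [Pi.pow_apply, ← pow_mul, integral_pow_two_gaussianReal]
  norm_num [integral_pow_four_gaussianReal]

/-- Realizes the norms for all `d` as partial sums along one i.i.d. sequence, so that a single
central limit theorem covers `d → ∞`. -/
lemma stdGaussian_map_norm_sq (d : ℕ) :
    (stdGaussian (EuclideanSpace ℝ (Fin d))).map (fun x ↦ ‖x‖ ^ 2) =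
      (Measure.infinitePi fun _ : ℕ ↦ gaussianReal 0 1).map
        (fun ω ↦ ∑ i ∈ Finset.range d, ω i ^ 2) := by
  rw [← map_pi_eq_stdGaussian, Measure.map_map (by fun_prop) (by fun_prop),
    ← Measure.infinitePi_eq_pi,
    ← Measure.map_infinitePi_infinitePi_of_inj (P := fun _ : ℕ ↦ gaussianReal 0 1)
      (f := fun i : Fin d ↦ (i : ℕ)) Fin.val_injective,
    Measure.map_map (by fun_prop) (by fun_prop)]
  congr 1
  ext ω
  simp [EuclideanSpace.real_norm_sq_eq, Finset.sum_range]

/-- The centred and normalized squared norm of a vector of `ℝ^d`; under the standard Gaussian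
distribution, it has mean `0` and variance `1`. -/
noncomputable def normalizedNormSq (d : ℕ) (x : EuclideanSpace ℝ (Fin d)) : ℝ :=
  (√(2 * d))⁻¹ * (‖x‖ ^ 2 - d)

@[fun_prop]
lemma measurable_normalizedNormSq (d : ℕ) : Measurable (normalizedNormSq d) := by
  unfold normalizedNormSq
  fun_prop

lemma identDistrib_normalizedNormSq (d : ℕ) :
    IdentDistrib (normalizedNormSq d)
      (fun ω ↦ (√(2 * d))⁻¹ * (∑ i ∈ Finset.range d, ω i ^ 2 - d))
      (stdGaussian (EuclideanSpace ℝ (Fin d)))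
      (Measure.infinitePi fun _ : ℕ ↦ gaussianReal 0 1) :=
  (IdentDistrib.mk (by fun_prop) (Measurable.aemeasurable (by fun_prop)) (stdGaussian_map_norm_sq d)).comp
    (u := fun y ↦ (√(2 * d))⁻¹ * (y - d)) (by fun_prop)

lemma iIndepFun_sq_infinitePi :
    iIndepFun (fun i (ω : ℕ → ℝ) ↦ ω i ^ 2) (Measure.infinitePi fun _ : ℕ ↦ gaussianReal 0 1) :=
  iIndepFun_infinitePi (X := fun _ x ↦ x ^ 2) (by fun_prop)

lemma identDistrib_eval_infinitePi {X Y : Type*} [MeasurableSpace X] [MeasurableSpace Y]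
    (m : Measure X) [IsProbabilityMeasure m] {f : X → Y} (hf : Measurable f) (i : ℕ) :
    IdentDistrib (fun ω : ℕ → X ↦ f (ω i)) f (Measure.infinitePi fun _ ↦ m) m :=
  (IdentDistrib.mk (f := fun ω : ℕ → X ↦ ω i) (g := id) (Measurable.aemeasurable (by fun_prop)) (by fun_prop)
    (by rw [Measure.infinitePi_map_eval, Measure.map_id])).comp hf

lemma memLp_eval_sq_infinitePi (i : ℕ) :
    MemLp (fun ω : ℕ → ℝ ↦ ω i ^ 2) 2 (Measure.infinitePi fun _ ↦ gaussianReal 0 1) :=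
  (identDistrib_eval_infinitePi (gaussianReal 0 1) (f := fun x ↦ x ^ 2)
    (by fun_prop) i).memLp_iff.2 memLp_sq_gaussianReal

lemma memLp_normalizedNormSq (d : ℕ) :
    MemLp (normalizedNormSq d) 2 (stdGaussian (EuclideanSpace ℝ (Fin d))) := by
  rw [(identDistrib_normalizedNormSq d).memLp_iff]
  have h : MemLp (fun ω : ℕ → ℝ ↦ ∑ i ∈ Finset.range d, ω i ^ 2) 2
      (Measure.infinitePi fun _ ↦ gaussianReal 0 1) :=
    memLp_finsetSum _ fun i _ ↦ memLp_eval_sq_infinitePi i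
  exact (h.sub (memLp_const (d : ℝ))).const_mul _

lemma integral_normalizedNormSq (d : ℕ) :
    ∫ x, normalizedNormSq d x ∂(stdGaussian (EuclideanSpace ℝ (Fin d))) = 0 := by
  have hm (i : ℕ) := identDistrib_eval_infinitePi (gaussianReal 0 1) (f := fun x ↦ x ^ 2)
    (by fun_prop) i
  rw [(identDistrib_normalizedNormSq d).integral_eq, integral_const_mul, integral_sub,
    integral_finsetSum]
  · simp [fun i ↦ (hm i).integral_eq, integral_pow_two_gaussianReal]
  · exact fun i _ ↦ (memLp_eval_sq_infinitePi i).integrable one_le_two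
  · exact integrable_finsetSum _ fun i _ ↦
      (memLp_eval_sq_infinitePi i).integrable one_le_two
  · simp

lemma integral_normalizedNormSq_sq {d : ℕ} (hd : 0 < d) :
    ∫ x, normalizedNormSq d x ^ 2 ∂(stdGaussian (EuclideanSpace ℝ (Fin d))) = 1 := by
  have hm (i : ℕ) := identDistrib_eval_infinitePi (gaussianReal 0 1) (f := fun x ↦ x ^ 2)
    (by fun_prop) i
  have h := variance_eq_integral (X := normalizedNormSq d)
    (μ := stdGaussian (EuclideanSpace ℝ (Fin d))) (by fun_prop)
  simp only [integral_normalizedNormSq, sub_zero] at h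
  rw [← h, (identDistrib_normalizedNormSq d).variance_eq, variance_const_mul,
    variance_sub_const (Measurable.aestronglyMeasurable (by fun_prop))]
  have := IndepFun.variance_sum (s := Finset.range d)
    (fun i _ ↦ (memLp_eval_sq_infinitePi i))
    (fun i _ j _ hij ↦ iIndepFun_sq_infinitePi.indepFun hij)
  simp_rw [fun i ↦ (hm i).variance_eq, variance_sq_gaussianReal] at this
  rw [show (fun ω : ℕ → ℝ ↦ ∑ i ∈ Finset.range d, ω i ^ 2) =
    ∑ i ∈ Finset.range d, fun ω : ℕ → ℝ ↦ ω i ^ 2 by ext; simp, this]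
  have : (0 : ℝ) < d := by exact_mod_cast hd
  rw [inv_pow, Real.sq_sqrt (by positivity)]
  simp
  field_simp

lemma tendsto_charFun_normalizedNormSq (t : ℝ) :
    Tendsto (fun d : ℕ ↦ charFun
      ((stdGaussian (EuclideanSpace ℝ (Fin d))).map (normalizedNormSq d)) t) atTop
      (𝓝 (charFun (gaussianReal 0 1) t)) := by
  have hm (i : ℕ) := identDistrib_eval_infinitePi (gaussianReal 0 1) (f := fun x ↦ x ^ 2)
    (by fun_prop) i
  have h := (tendstoInDistribution_inv_sqrt_mul_sum_sub (P := Measure.infinitePi fun _ : ℕ ↦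
    gaussianReal 0 1) (X := fun i ω ↦ ω i ^ 2) (Y := id) HasLaw.id
    (memLp_eval_sq_infinitePi 0) iIndepFun_sq_infinitePi
    -- The factor `(√2)⁻¹` normalizes the variance `2` of a squared standard Gaussian.
    fun i ↦ (hm i).trans (hm 0).symm).continuous_comp (g := fun x ↦ (√2)⁻¹ * x) (by fun_prop)
  have := ProbabilityMeasure.tendsto_iff_tendsto_charFun.1 h.tendsto t
  simp only [ProbabilityMeasure.coe_mk, Function.comp_def] at this
  convert this using 2 with d
  · rw [(identDistrib_normalizedNormSq d).map_eq]
    congr with ω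
    rw [(hm 0).integral_eq, integral_pow_two_gaussianReal, mul_one, ← mul_assoc,
      Real.sqrt_mul zero_le_two, mul_inv]
  · simp only [(hm 0).variance_eq, variance_sq_gaussianReal, id_eq]
    rw [gaussianReal_map_const_mul]
    rw [mul_zero]
    refine congrArg (fun v ↦ charFun (gaussianReal 0 v) t) (NNReal.eq ?_)
    simp

end GaussianMoments

/-! ### Rotation invariance and uniqueness of the uniform law on the sphere -/

section Sphere

variable {E : Type*} [NormedAddCommGroup E] [InnerProductSpace ℝ E] [MeasurableSpace E]
  [BorelSpace E] [FiniteDimensional ℝ E]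

/-- There is only one rotation invariant probability measure on the unit sphere. -/
lemma eq_of_map_linearIsometryEquiv_eq {m₁ m₂ : Measure E} [IsProbabilityMeasure m₁]
    [IsProbabilityMeasure m₂] (h₁ : ∀ e : E ≃ₗᵢ[ℝ] E, m₁.map e = m₁)
    (h₂ : ∀ e : E ≃ₗᵢ[ℝ] E, m₂.map e = m₂) (hs₁ : ∀ᵐ x ∂m₁, ‖x‖ = 1) (hs₂ : ∀ᵐ x ∂m₂, ‖x‖ = 1) :
    m₁ = m₂ := by
  have hrot {m : Measure E} (h : ∀ e : E ≃ₗᵢ[ℝ] E, m.map e = m) {s t : E} (hst : ‖s‖ = ‖t‖) :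
      charFun m s = charFun m t := by
    -- A reflection exchanges two vectors of equal norm, so the characteristic function is radial.
    let e := Submodule.reflection (ℝ ∙ (t - s))ᗮ
    have he : e t = s := Submodule.reflection_sub hst.symm
    conv_lhs => rw [← h e]
    rw [charFun_apply, integral_map (by fun_prop) (by fun_prop), charFun_apply]
    simp_rw [← he, e.inner_map_map]
  apply Measure.ext_of_charFun
  ext t
  -- Averaging the radial function `charFun m` over a sphere of radius `‖t‖` does not change it. The
  -- resulting double integral is symmetric in the two measures, so Fubini identifies their
  -- characteristic functions.
  have key {m m' : Measure E} [IsProbabilityMeasure m] [IsProbabilityMeasure m']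
      (h : ∀ e : E ≃ₗᵢ[ℝ] E, m.map e = m) (hs : ∀ᵐ x ∂m', ‖x‖ = 1) :
      ∫ y, ∫ x, Complex.exp (inner ℝ x (‖t‖ • y) * Complex.I) ∂m ∂m' = charFun m t := by
    rw [integral_congr_ae (g := fun _ ↦ charFun m t)]
    · simp
    · filter_upwards [hs] with y hy
      rw [← charFun_apply]
      exact hrot h (by simp [norm_smul, hy])
  rw [← key h₁ hs₂, ← key h₂ hs₁, integral_integral_swap]
  · simp_rw [real_inner_smul_right, real_inner_comm]
  · refine Integrable.of_bound (C := 1) (Measurable.aestronglyMeasurable ?_) ?_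
    · unfold Function.uncurry
      fun_prop
    · refine ae_of_all _ fun z ↦ ?_
      simp [Function.uncurry, Complex.norm_exp_ofReal_mul_I]

/-- The radial projection to the unit sphere (which sends `0` to `0`). -/
noncomputable def direction (x : E) : E := ‖x‖⁻¹ • x

omit [FiniteDimensional ℝ E] in
@[fun_prop]
lemma measurable_direction [SecondCountableTopology E] : Measurable (direction : E → E) := by
  unfold direction
  fun_prop

end Sphere

/-! ### Uniform directions from Gaussian vectors -/

lemma ae_ne_zero_stdGaussian (d : ℕ) [NeZero d] :
    ∀ᵐ x ∂(stdGaussian (EuclideanSpace ℝ (Fin d))), x ≠ 0 := by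
  rw [← map_pi_eq_stdGaussian, ae_map_iff (p := fun x ↦ x ≠ 0) (by fun_prop)
    (measurableSet_singleton 0).compl]
  have : ∀ᵐ y ∂(gaussianReal 0 1), y ≠ 0 := by
    have := nullSingletonClass_gaussianReal (μ := 0) (v := 1) one_ne_zero
    simp [ae_iff]
  have h := (measurePreserving_eval (fun _ : Fin d ↦ gaussianReal 0 1) 0).quasiMeasurePreserving.ae
    this
  filter_upwards [h] with x hx h0
  exact hx (by simpa using congrArg (fun y ↦ y 0) h0)

instance isProbabilityMeasure_uniformUnitSphere (d : ℕ) [NeZero d] :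
    IsProbabilityMeasure (uniformUnitSphere d) := by
  have : IsProbabilityMeasure (ProbabilityTheory.cond
      (volume : Measure (EuclideanSpace ℝ (Fin d))).toSphere Set.univ) := by
    apply cond_isProbabilityMeasure
    have := Measure.toSphere_ne_zero (volume : Measure (EuclideanSpace ℝ (Fin d)))
    exact Measure.measure_univ_ne_zero.2 this
  exact Measure.isProbabilityMeasure_map (by fun_prop)

/-- Surface measure is, up to a constant, the volume of the cone over a set, and linear isometries
preserve volume and commute with forming cones. -/
lemma uniformUnitSphere_map_linearIsometryEquiv (d : ℕ)
    (e : EuclideanSpace ℝ (Fin d) ≃ₗᵢ[ℝ] EuclideanSpace ℝ (Fin d)) :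
    (uniformUnitSphere d).map e = uniformUnitSphere d := by
  ext s hs
  have hes : MeasurableSet (e ⁻¹' s) := e.continuous.measurable hs
  rw [Measure.map_apply e.continuous.measurable hs, uniformUnitSphere,
    Measure.map_apply measurable_subtype_coe hes, Measure.map_apply measurable_subtype_coe hs,
    cond_apply MeasurableSet.univ, cond_apply MeasurableSet.univ, Set.univ_inter, Set.univ_inter,
    Measure.toSphere_apply' _ (measurable_subtype_coe hs),
    Measure.toSphere_apply' _ (measurable_subtype_coe hes)]
  congr 2
  conv_rhs => rw [← e.measurePreserving.measure_preimage_emb e.toHomeomorph.measurableEmbedding]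
  congr 1
  ext x
  simp only [Set.mem_smul, Set.mem_image, Set.mem_preimage, Subtype.exists, exists_and_right,
    exists_eq_right, mem_sphere_iff_norm, sub_zero]
  constructor
  · rintro ⟨r, hr, y, ⟨hy, hys⟩, rfl⟩
    exact ⟨r, hr, e y, ⟨by simpa using hy, hys⟩, by simp⟩
  · rintro ⟨r, hr, y, ⟨hy, hys⟩, h⟩
    exact ⟨r, hr, e.symm y, ⟨by simpa using hy, by simpa using hys⟩, e.injective (by simpa using h)⟩

lemma stdGaussian_map_direction (d : ℕ) [NeZero d] :
    (stdGaussian (EuclideanSpace ℝ (Fin d))).map direction = uniformUnitSphere d := by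
  have : IsProbabilityMeasure ((stdGaussian (EuclideanSpace ℝ (Fin d))).map direction) :=
    Measure.isProbabilityMeasure_map (by fun_prop)
  apply eq_of_map_linearIsometryEquiv_eq
  · intro e
    rw [Measure.map_map (by fun_prop) (by fun_prop)]
    conv_rhs => rw [← stdGaussian_map e, Measure.map_map (by fun_prop) (by fun_prop)]
    refine congrArg (fun f ↦ Measure.map f _) (funext fun x ↦ ?_)
    simp [direction]
  · exact uniformUnitSphere_map_linearIsometryEquiv d
  · rw [ae_map_iff (by fun_prop) (measurableSet_eq_fun (by fun_prop) (by fun_prop))]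
    filter_upwards [ae_ne_zero_stdGaussian d] with x hx
    simp [direction, norm_smul, hx]
  · rw [uniformUnitSphere, ae_map_iff (by fun_prop)
      (measurableSet_eq_fun (by fun_prop) (by fun_prop))]
    exact ae_of_all _ fun x ↦ by simp

/-! ### The error of replacing directions by rescaled Gaussian vectors -/

section Kernel

variable {d : ℕ}

/-- The relative deviation of the squared norm of a standard Gaussian vector from its mean. -/
noncomputable def normSqDeviation (d : ℕ) (x : EuclideanSpace ℝ (Fin d)) : ℝ := ‖x‖ ^ 2 / d - 1

@[fun_prop]
lemma measurable_normSqDeviation : Measurable (normSqDeviation d) := by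
  unfold normSqDeviation
  fun_prop

lemma normSqDeviation_eq [NeZero d] (x : EuclideanSpace ℝ (Fin d)) :
    normSqDeviation d x = √(2 / d) * normalizedNormSq d x := by
  have hd : (0 : ℝ) < d := by exact_mod_cast NeZero.pos d
  have h2 : √(2 : ℝ) ≠ 0 := by positivity
  have h3 : √(d : ℝ) ≠ 0 := by positivity
  rw [normSqDeviation, normalizedNormSq, Real.sqrt_div zero_le_two, Real.sqrt_mul zero_le_two]
  field_simp
  rw [Real.sq_sqrt hd.le]
  ring

lemma memLp_normSqDeviation [NeZero d] :
    MemLp (normSqDeviation d) 2 (stdGaussian (EuclideanSpace ℝ (Fin d))) := by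
  rw [funext normSqDeviation_eq]
  exact (memLp_normalizedNormSq d).const_mul _

lemma integral_normSqDeviation [NeZero d] :
    ∫ x, normSqDeviation d x ∂(stdGaussian (EuclideanSpace ℝ (Fin d))) = 0 := by
  simp_rw [normSqDeviation_eq, integral_const_mul, integral_normalizedNormSq, mul_zero]

lemma integral_normSqDeviation_sq [NeZero d] :
    ∫ x, normSqDeviation d x ^ 2 ∂(stdGaussian (EuclideanSpace ℝ (Fin d))) = 2 / d := by
  simp_rw [normSqDeviation_eq, mul_pow, integral_const_mul,
    integral_normalizedNormSq_sq (NeZero.pos d), mul_one]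
  exact Real.sq_sqrt (by positivity)

lemma integrable_norm_sq_div [NeZero d] :
    Integrable (fun x ↦ ‖x‖ ^ 2 / d) (stdGaussian (EuclideanSpace ℝ (Fin d))) := by
  have := (memLp_normSqDeviation (d := d)).integrable one_le_two |>.add (integrable_const 1)
  refine this.congr (ae_of_all _ fun x ↦ ?_)
  simp [normSqDeviation]

lemma integral_norm_sq_div [NeZero d] :
    ∫ x, ‖x‖ ^ 2 / d ∂(stdGaussian (EuclideanSpace ℝ (Fin d))) = 1 := by
  have := integral_normSqDeviation (d := d)
  unfold normSqDeviation at this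
  rw [integral_sub integrable_norm_sq_div (integrable_const 1)] at this
  simp at this
  linarith

lemma norm_direction_le (x : EuclideanSpace ℝ (Fin d)) : ‖direction x‖ ≤ 1 := by
  rw [direction, norm_smul, norm_inv, norm_norm]
  exact inv_mul_le_one

lemma inner_sq_le_one {u v : EuclideanSpace ℝ (Fin d)} (hu : ‖u‖ ≤ 1) (hv : ‖v‖ ≤ 1) :
    inner ℝ u v ^ 2 ≤ 1 := by
  rw [sq_le_one_iff_abs_le_one]
  exact (abs_real_inner_le_norm u v).trans (mul_le_one₀ hu (norm_nonneg _) hv)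

/-- By rotation invariance `u` may be replaced by any basis vector; summing over the basis yields
`‖direction x‖² ≤ 1`. The gain is a factor `1 / d`. Allowing a radial weight `f` avoids proving that
norm and direction are independent. -/
lemma mul_integral_inner_direction_sq_mul_le {u : EuclideanSpace ℝ (Fin d)}
    (hu : ‖u‖ = 1) {f : ℝ → ℝ} (hf : Measurable f) (hf0 : ∀ r, 0 ≤ f r)
    (hint : Integrable (fun x ↦ f ‖x‖) (stdGaussian (EuclideanSpace ℝ (Fin d)))) :
    d * ∫ x, inner ℝ u (direction x) ^ 2 * f ‖x‖ ∂(stdGaussian (EuclideanSpace ℝ (Fin d))) ≤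
      ∫ x, f ‖x‖ ∂(stdGaussian (EuclideanSpace ℝ (Fin d))) := by
  set γ := stdGaussian (EuclideanSpace ℝ (Fin d))
  let b := EuclideanSpace.basisFun (Fin d) ℝ
  have hrot (i : Fin d) : ∫ x, inner ℝ u (direction x) ^ 2 * f ‖x‖ ∂γ =
      ∫ x, inner ℝ (b i) (direction x) ^ 2 * f ‖x‖ ∂γ := by
    let e := Submodule.reflection (ℝ ∙ (u - b i))ᗮ
    have he : e u = b i := Submodule.reflection_sub (by rw [hu, b.norm_eq_one])
    conv_rhs => rw [show γ = γ.map e from (stdGaussian_map e).symm]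
    rw [integral_map (by fun_prop) (Measurable.aestronglyMeasurable (by fun_prop))]
    have hdir (x : EuclideanSpace ℝ (Fin d)) : direction (e x) = e (direction x) := by
      simp [direction]
    simp_rw [hdir, ← he, e.inner_map_map, e.norm_map]
  have hint' (i : Fin d) : Integrable (fun x ↦ inner ℝ (b i) (direction x) ^ 2 * f ‖x‖) γ := by
    refine hint.bdd_mul (c := 1) (Measurable.aestronglyMeasurable (by fun_prop))
      (ae_of_all _ fun x ↦ ?_)
    rw [Real.norm_of_nonneg (by positivity)]
    exact inner_sq_le_one (b.norm_eq_one i).le (norm_direction_le x)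
  calc d * ∫ x, inner ℝ u (direction x) ^ 2 * f ‖x‖ ∂γ
      = ∑ i : Fin d, ∫ x, inner ℝ (b i) (direction x) ^ 2 * f ‖x‖ ∂γ := by
        rw [← Finset.sum_congr rfl fun i _ ↦ hrot i]
        simp
    _ = ∫ x, ‖direction x‖ ^ 2 * f ‖x‖ ∂γ := by
        rw [← integral_finsetSum _ fun i _ ↦ hint' i]
        simp_rw [← Finset.sum_mul, b.sum_sq_inner_right]
    _ ≤ ∫ x, f ‖x‖ ∂γ := by
        refine integral_mono_of_nonneg (ae_of_all _ fun x ↦ mul_nonneg (by positivity) (hf0 _))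
          hint (ae_of_all _ fun x ↦ ?_)
        exact mul_le_of_le_one_left (hf0 _)
          (pow_le_one₀ (norm_nonneg _) (norm_direction_le x))

/-- The error made when the inner product of the directions of two vectors of `ℝ^d` is replaced
by their rescaled inner product. -/
noncomputable def directionKernel (d : ℕ) (x y : EuclideanSpace ℝ (Fin d)) : ℝ :=
  inner ℝ (direction x) (direction y) - inner ℝ x y / d

@[fun_prop]
lemma measurable_directionKernel :
    Measurable (fun p : EuclideanSpace ℝ (Fin d) × EuclideanSpace ℝ (Fin d) ↦
      directionKernel d p.1 p.2) := by
  unfold directionKernel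
  fun_prop

lemma directionKernel_comm (x y : EuclideanSpace ℝ (Fin d)) :
    directionKernel d x y = directionKernel d y x := by
  simp [directionKernel, real_inner_comm]

lemma directionKernel_neg_left (x y : EuclideanSpace ℝ (Fin d)) :
    directionKernel d (-x) y = -directionKernel d x y := by
  simp [directionKernel, direction]
  ring

lemma directionKernel_neg_right (x y : EuclideanSpace ℝ (Fin d)) :
    directionKernel d x (-y) = -directionKernel d x y := by
  rw [directionKernel_comm, directionKernel_neg_left, directionKernel_comm]

/-- Separates an angular factor, whose square averages to order `1 / d`, from a radial factor that
is small because norms concentrate at `√d`. -/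
lemma directionKernel_eq (x y : EuclideanSpace ℝ (Fin d)) :
    directionKernel d x y = inner ℝ (direction x) (direction y) * (1 - ‖x‖ * ‖y‖ / d) := by
  rcases eq_or_ne x 0 with rfl | hx
  · simp [directionKernel, direction]
  rcases eq_or_ne y 0 with rfl | hy
  · simp [directionKernel, direction]
  have hx' : ‖x‖ ≠ 0 := by simpa
  have hy' : ‖y‖ ≠ 0 := by simpa
  simp only [directionKernel, direction, real_inner_smul_left, real_inner_smul_right]
  field_simp

/-- With `a = ‖x‖ / √d` and `b = ‖y‖ / √d`, write `1 - ab = (1 - a) + a (1 - b)` and use `(1 - a)² ≤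
(1 - a²)²` for `a ≥ 0`. This leaves only squared norms, whose moments are explicit. -/
lemma one_sub_mul_sq_le [NeZero d] (x y : EuclideanSpace ℝ (Fin d)) :
    (1 - ‖x‖ * ‖y‖ / d) ^ 2 ≤
      2 * normSqDeviation d x ^ 2 + 2 * (‖x‖ ^ 2 / d * normSqDeviation d y ^ 2) := by
  have hd : (0 : ℝ) < d := by exact_mod_cast NeZero.pos d
  have hs : √(d : ℝ) * √d = d := Real.mul_self_sqrt hd.le
  have aux (r : ℝ) (hr : 0 ≤ r) : (1 - r) ^ 2 ≤ (r ^ 2 - 1) ^ 2 := by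
    have : (r ^ 2 - 1) ^ 2 = (1 - r) ^ 2 * (1 + r) ^ 2 := by ring
    rw [this]
    exact le_mul_of_one_le_right (sq_nonneg _) (one_le_pow₀ (by linarith))
  obtain ⟨a, ha0, ha⟩ : ∃ a : ℝ, 0 ≤ a ∧ ‖x‖ = a * √d :=
    ⟨‖x‖ / √d, by positivity, by field_simp⟩
  obtain ⟨b, hb0, hb⟩ : ∃ b : ℝ, 0 ≤ b ∧ ‖y‖ = b * √d :=
    ⟨‖y‖ / √d, by positivity, by field_simp⟩
  have e1 : ‖x‖ ^ 2 / d = a ^ 2 := by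
    rw [ha, mul_pow, Real.sq_sqrt hd.le]
    field_simp
  have e2 : ‖y‖ ^ 2 / d = b ^ 2 := by
    rw [hb, mul_pow, Real.sq_sqrt hd.le]
    field_simp
  have e3 : ‖x‖ * ‖y‖ / d = a * b := by
    rw [ha, hb, mul_mul_mul_comm, hs]
    field_simp
  rw [normSqDeviation, normSqDeviation, e1, e2, e3]
  have h1 := aux a ha0
  have h2 := mul_le_mul_of_nonneg_left (aux b hb0) (sq_nonneg a)
  have h3 : (1 - a * b) ^ 2 ≤ 2 * (1 - a) ^ 2 + 2 * (a ^ 2 * (1 - b) ^ 2) := by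
    nlinarith [sq_nonneg ((1 - a) - a * (1 - b))]
  linarith

lemma integrable_bound_directionKernel [NeZero d] :
    Integrable (fun p : EuclideanSpace ℝ (Fin d) × EuclideanSpace ℝ (Fin d) ↦
        2 * normSqDeviation d p.1 ^ 2 + 2 * (‖p.1‖ ^ 2 / d * normSqDeviation d p.2 ^ 2))
      ((stdGaussian (EuclideanSpace ℝ (Fin d))).prod (stdGaussian (EuclideanSpace ℝ (Fin d)))) := by
  have h := (memLp_normSqDeviation (d := d)).integrable_sq
  exact ((h.comp_fst _).const_mul 2).add ((integrable_norm_sq_div.mul_prod h).const_mul 2)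

lemma directionKernel_sq_le [NeZero d] (x y : EuclideanSpace ℝ (Fin d)) :
    directionKernel d x y ^ 2 ≤
      2 * normSqDeviation d x ^ 2 + 2 * (‖x‖ ^ 2 / d * normSqDeviation d y ^ 2) := by
  rw [directionKernel_eq, mul_pow]
  exact (mul_le_of_le_one_left (sq_nonneg _)
    (inner_sq_le_one (norm_direction_le x) (norm_direction_le y))).trans (one_sub_mul_sq_le x y)

lemma memLp_directionKernel [NeZero d] :
    MemLp (fun p : EuclideanSpace ℝ (Fin d) × EuclideanSpace ℝ (Fin d) ↦
        directionKernel d p.1 p.2) 2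
      ((stdGaussian (EuclideanSpace ℝ (Fin d))).prod (stdGaussian (EuclideanSpace ℝ (Fin d)))) := by
  rw [memLp_two_iff_integrable_sq (by fun_prop)]
  refine integrable_bound_directionKernel.mono' (by fun_prop) (ae_of_all _ fun p ↦ ?_)
  rw [Real.norm_of_nonneg (sq_nonneg _)]
  exact directionKernel_sq_le p.1 p.2

/-- For fixed `x ≠ 0`, integrating over `y` gains `1 / d` from the angle; the radial bound then
integrates to `2 · (2 / d) + 2 · (2 / d)`. -/
lemma integral_directionKernel_sq_le [NeZero d] :
    ∫ p, directionKernel d p.1 p.2 ^ 2 ∂((stdGaussian (EuclideanSpace ℝ (Fin d))).prod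
      (stdGaussian (EuclideanSpace ℝ (Fin d)))) ≤ 8 / d ^ 2 := by
  have hd : (0 : ℝ) < d := by exact_mod_cast NeZero.pos d
  set γ := stdGaussian (EuclideanSpace ℝ (Fin d))
  have hq := (memLp_normSqDeviation (d := d)).integrable_sq
  have hinner : ∀ᵐ x ∂γ, ∫ y, directionKernel d x y ^ 2 ∂γ ≤
      (2 * normSqDeviation d x ^ 2 + 2 * (‖x‖ ^ 2 / d * (2 / d))) / d := by
    filter_upwards [ae_ne_zero_stdGaussian d] with x hx
    have hbd : Integrable (fun y ↦ 2 * normSqDeviation d x ^ 2 +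
        2 * (‖x‖ ^ 2 / d * normSqDeviation d y ^ 2)) γ :=
      (integrable_const _).add ((hq.const_mul _).const_mul _)
    have hint : Integrable (fun y ↦ (1 - ‖x‖ * ‖y‖ / d) ^ 2) γ := by
      refine hbd.mono' (by fun_prop) (ae_of_all _ fun y ↦ ?_)
      rw [Real.norm_of_nonneg (sq_nonneg _)]
      exact one_sub_mul_sq_le x y
    have h := mul_integral_inner_direction_sq_mul_le (u := direction x)
      (by simp [direction, norm_smul, hx]) (f := fun r ↦ (1 - ‖x‖ * r / d) ^ 2) (by fun_prop)
      (fun r ↦ sq_nonneg _) hint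
    rw [le_div_iff₀' hd]
    simp_rw [directionKernel_eq, mul_pow]
    refine h.trans ((integral_mono hint hbd fun y ↦ one_sub_mul_sq_le x y).trans_eq ?_)
    rw [integral_add (integrable_const _) ((hq.const_mul _).const_mul _), integral_const_mul,
      integral_const_mul, integral_const_mul, integral_normSqDeviation_sq]
    simp
  rw [integral_prod _ memLp_directionKernel.integrable_sq]
  refine (integral_mono_ae memLp_directionKernel.integrable_sq.integral_prod_left
    (((hq.const_mul 2).add ((integrable_norm_sq_div.mul_const (2 / (d : ℝ))).const_mul 2)).div_const
      (d : ℝ)) hinner).trans_eq ?_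
  simp only [Pi.add_apply]
  rw [integral_div, integral_add (hq.const_mul 2)
    ((integrable_norm_sq_div.mul_const (2 / (d : ℝ))).const_mul 2), integral_const_mul,
    integral_const_mul, integral_mul_const, integral_normSqDeviation_sq, integral_norm_sq_div]
  field_simp
  norm_num

end Kernel

/-! ### Orthogonality of the errors and the conditional Gaussian law -/

section Sequences

variable {d : ℕ}

lemma measurePreserving_eval_pair {X : Type*} [MeasurableSpace X] (m : Measure X)
    [IsProbabilityMeasure m] {i j : ℕ} (hij : i ≠ j) :
    MeasurePreserving (fun ω : ℕ → X ↦ (ω i, ω j)) (Measure.infinitePi fun _ ↦ m) (m.prod m) :=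
  ⟨by fun_prop, Measure.infinitePi_map_eval_prod hij⟩

lemma integral_comp_eval_pair {X : Type*} [MeasurableSpace X] (m : Measure X)
    [IsProbabilityMeasure m] {f : X × X → ℝ} (hf : Measurable f) {i j : ℕ} (hij : i ≠ j) :
    ∫ ω, f (ω i, ω j) ∂(Measure.infinitePi fun _ : ℕ ↦ m) = ∫ x, f x ∂(m.prod m) := by
  rw [← (measurePreserving_eval_pair m hij).map_eq,
    integral_map (Measurable.aemeasurable (by fun_prop)) hf.aestronglyMeasurable]

/-- Changing the sign of the `k`-th entry of a sequence. -/
def flipEntry {E : Type*} [Neg E] (k : ℕ) (g : ℕ → E) (i : ℕ) : E := if i = k then -g i else g i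

lemma measurePreserving_flipEntry (k : ℕ) :
    MeasurePreserving (flipEntry k)
      (Measure.infinitePi fun _ : ℕ ↦ stdGaussian (EuclideanSpace ℝ (Fin d)))
      (Measure.infinitePi fun _ : ℕ ↦ stdGaussian (EuclideanSpace ℝ (Fin d))) := by
  have hf (i : ℕ) : Measurable fun x : EuclideanSpace ℝ (Fin d) ↦ if i = k then -x else x := by
    split_ifs <;> fun_prop
  refine ⟨measurable_pi_lambda _ fun i ↦ (hf i).comp (measurable_pi_apply i), ?_⟩
  refine (Measure.infinitePi_map_pi _ hf).trans (congrArg _ (funext fun i ↦ ?_))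
  split_ifs
  · exact stdGaussian_map (LinearIsometryEquiv.neg ℝ)
  · exact Measure.map_id'

/-- The integral equals its own negative by invariance under the flip; integrability is not needed.
-/
lemma integral_eq_zero_of_flipEntry (k : ℕ) {f : (ℕ → EuclideanSpace ℝ (Fin d)) → ℝ}
    (hf : Measurable f) (h : ∀ g, f (flipEntry k g) = -f g) :
    ∫ g, f g ∂(Measure.infinitePi fun _ ↦ stdGaussian (EuclideanSpace ℝ (Fin d))) = 0 := by
  have h1 := integral_map (μ := Measure.infinitePi fun _ ↦ stdGaussian (EuclideanSpace ℝ (Fin d)))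
    (measurePreserving_flipEntry (d := d) k).measurable.aemeasurable
    hf.aestronglyMeasurable
  rw [(measurePreserving_flipEntry k).map_eq] at h1
  simp_rw [h, integral_neg] at h1
  linarith

lemma measurable_directionKernel_eval (i j : ℕ) :
    Measurable fun g : ℕ → EuclideanSpace ℝ (Fin d) ↦ directionKernel d (g i) (g j) :=
  measurable_directionKernel.comp (f := fun g : ℕ → EuclideanSpace ℝ (Fin d) ↦ (g i, g j))
    (by fun_prop)

lemma integral_directionKernel_mul_eq_zero {i j k l : ℕ} (hij : i < j) (hkl : k < l)
    (h : i = k → j ≠ l) :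
    ∫ g, directionKernel d (g i) (g j) * directionKernel d (g k) (g l)
      ∂(Measure.infinitePi fun _ ↦ stdGaussian (EuclideanSpace ℝ (Fin d))) = 0 := by
  have hm : Measurable fun g : ℕ → EuclideanSpace ℝ (Fin d) ↦
      directionKernel d (g i) (g j) * directionKernel d (g k) (g l) :=
    (measurable_directionKernel_eval i j).mul (measurable_directionKernel_eval k l)
  -- Some index occurs in only one of the two pairs, and flipping its vector changes the sign. If
  -- `i` is shared, the ordering of the pairs and `h` force `j` to be unshared; otherwise `i` itself
  -- serves.
  by_cases hi : i = k ∨ i = l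
  · refine integral_eq_zero_of_flipEntry j hm fun g ↦ ?_
    simp [flipEntry, show i ≠ j by omega, show k ≠ j by omega, show l ≠ j by omega,
      directionKernel_neg_right]
  · refine integral_eq_zero_of_flipEntry i hm fun g ↦ ?_
    simp [flipEntry, show j ≠ i by omega, show k ≠ i by omega, show l ≠ i by omega,
      directionKernel_neg_left]

lemma norm_sum_range_sq {E : Type*} [NormedAddCommGroup E] [InnerProductSpace ℝ E] (v : ℕ → E)
    (n : ℕ) : ‖∑ i ∈ Finset.range n, v i‖ ^ 2 = ∑ i ∈ Finset.range n, ‖v i‖ ^ 2 +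
      2 * ∑ j ∈ Finset.range n, ∑ i ∈ Finset.range j, inner ℝ (v i) (v j) := by
  induction n with
  | zero => simp
  | succ n ih =>
    rw [Finset.sum_range_succ, norm_add_sq_real, ih, Finset.sum_range_succ, Finset.sum_range_succ,
      sum_inner]
    ring

variable (μ : Measure ℝ) [IsProbabilityMeasure μ]

/-- The joint law of an i.i.d. sequence with law `μ` and an independent i.i.d. sequence of
standard Gaussian vectors of `ℝ^d`. -/
noncomputable def radialGaussian (d : ℕ) : Measure ((ℕ → ℝ) × (ℕ → EuclideanSpace ℝ (Fin d))) :=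
  (Measure.infinitePi fun _ ↦ μ).prod
    (Measure.infinitePi fun _ ↦ stdGaussian (EuclideanSpace ℝ (Fin d)))

instance : IsProbabilityMeasure (radialGaussian μ d) := by
  unfold radialGaussian
  infer_instance

variable {μ}

omit [IsProbabilityMeasure μ] in
lemma memLp_sq_of_integrable_pow_four (h4 : Integrable (fun x ↦ x ^ 4) μ) :
    MemLp (fun x ↦ x ^ 2) 2 μ := by
  rw [memLp_two_iff_integrable_sq (by fun_prop)]
  simpa only [← pow_mul] using h4

lemma integrable_sq_of_integrable_pow_four (h4 : Integrable (fun x ↦ x ^ 4) μ) :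
    Integrable (fun x ↦ x ^ 2) μ :=
  (memLp_sq_of_integrable_pow_four h4).integrable one_le_two

lemma memLp_radial_directionKernel [NeZero d] (h4 : Integrable (fun x ↦ x ^ 4) μ) {i j : ℕ}
    (hij : i ≠ j) :
    MemLp (fun p ↦ p.1 i * p.1 j * directionKernel d (p.2 i) (p.2 j)) 2 (radialGaussian μ d) := by
  have hm := (measurable_directionKernel_eval (d := d) i j)
  rw [memLp_two_iff_integrable_sq (Measurable.aestronglyMeasurable (by fun_prop))]
  have h1 : Integrable (fun r : ℕ → ℝ ↦ r i ^ 2 * r j ^ 2) (Measure.infinitePi fun _ ↦ μ) :=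
    (measurePreserving_eval_pair μ hij).integrable_comp_of_integrable
      (g := fun x : ℝ × ℝ ↦ x.1 ^ 2 * x.2 ^ 2) ((integrable_sq_of_integrable_pow_four h4).mul_prod
        (integrable_sq_of_integrable_pow_four h4))
  have h2 := (measurePreserving_eval_pair (stdGaussian (EuclideanSpace ℝ (Fin d)))
    hij).integrable_comp_of_integrable memLp_directionKernel.integrable_sq
  refine (h1.mul_prod h2).congr (ae_of_all _ fun p ↦ ?_)
  simp [mul_pow]

lemma integral_radial_directionKernel_sq_le [NeZero d] (h2 : ∫ x, x ^ 2 ∂μ = 1) {i j : ℕ}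
    (hij : i ≠ j) :
    ∫ p, (p.1 i * p.1 j * directionKernel d (p.2 i) (p.2 j)) ^ 2 ∂(radialGaussian μ d) ≤
      8 / d ^ 2 := by
  simp_rw [mul_pow]
  rw [radialGaussian, integral_prod_mul (fun r : ℕ → ℝ ↦ r i ^ 2 * r j ^ 2)
    (fun g : ℕ → EuclideanSpace ℝ (Fin d) ↦ directionKernel d (g i) (g j) ^ 2)]
  rw [integral_comp_eval_pair μ (f := fun x ↦ x.1 ^ 2 * x.2 ^ 2) (by fun_prop) hij,
    integral_prod_mul (fun x : ℝ ↦ x ^ 2) (fun x ↦ x ^ 2), h2, mul_one, one_mul,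
    integral_comp_eval_pair (stdGaussian (EuclideanSpace ℝ (Fin d)))
      (f := fun x ↦ directionKernel d x.1 x.2 ^ 2) (by fun_prop) hij]
  exact integral_directionKernel_sq_le

lemma integral_radial_directionKernel_mul {i j k l : ℕ} (hij : i < j) (hkl : k < l)
    (h : i = k → j ≠ l) :
    ∫ p, (p.1 i * p.1 j * directionKernel d (p.2 i) (p.2 j)) *
      (p.1 k * p.1 l * directionKernel d (p.2 k) (p.2 l)) ∂(radialGaussian μ d) = 0 := by
  have h0 := integral_prod_mul (μ := Measure.infinitePi fun _ : ℕ ↦ μ)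
    (ν := Measure.infinitePi fun _ : ℕ ↦ stdGaussian (EuclideanSpace ℝ (Fin d)))
    (fun r : ℕ → ℝ ↦ r i * r j * (r k * r l))
    (fun g ↦ directionKernel d (g i) (g j) * directionKernel d (g k) (g l))
  rw [integral_directionKernel_mul_eq_zero hij hkl h, mul_zero] at h0
  rw [← h0, radialGaussian]
  congr with p
  ring

lemma memLp_sum_directionKernel [NeZero d] (h4 : Integrable (fun x ↦ x ^ 4) μ) (n : ℕ) :
    MemLp (fun p ↦ ∑ j ∈ Finset.range n, ∑ i ∈ Finset.range j,
      p.1 i * p.1 j * directionKernel d (p.2 i) (p.2 j)) 2 (radialGaussian μ d) :=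
  memLp_finsetSum _ fun _ _ ↦ memLp_finsetSum _ fun _ hi ↦
    memLp_radial_directionKernel h4 (Finset.mem_range.1 hi).ne

/-- Orthogonality leaves only the diagonal contributions of at most `n²` pairs; without it the bound
would be of order `n⁴ / d²`. -/
lemma integral_sum_directionKernel_sq_le [NeZero d] (h2 : ∫ x, x ^ 2 ∂μ = 1)
    (h4 : Integrable (fun x ↦ x ^ 4) μ) (n : ℕ) :
    ∫ p, (∑ j ∈ Finset.range n, ∑ i ∈ Finset.range j,
      p.1 i * p.1 j * directionKernel d (p.2 i) (p.2 j)) ^ 2 ∂(radialGaussian μ d) ≤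
      n ^ 2 * (8 / d ^ 2) := by
  simp_rw [Finset.sum_sigma']
  rw [integral_sum_sq_of_orthogonal]
  · refine (Finset.sum_le_card_nsmul _ _ (8 / (d : ℝ) ^ 2) fun q hq ↦ ?_).trans ?_
    · simp only [Finset.mem_sigma, Finset.mem_range] at hq
      exact integral_radial_directionKernel_sq_le h2 hq.2.ne
    · rw [nsmul_eq_mul]
      gcongr
      rw [Finset.card_sigma]
      norm_cast
      calc ∑ j ∈ Finset.range n, (Finset.range j).card
          ≤ ∑ j ∈ Finset.range n, n := Finset.sum_le_sum fun j hj ↦ by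
            simpa using (Finset.mem_range.1 hj).le
        _ = n ^ 2 := by simp [sq]
  · intro q hq
    simp only [Finset.mem_sigma, Finset.mem_range] at hq
    exact memLp_radial_directionKernel h4 hq.2.ne
  · rintro ⟨j, i⟩ hq ⟨l, k⟩ hq' hne
    simp only [Finset.mem_sigma, Finset.mem_range] at hq hq'
    exact integral_radial_directionKernel_mul hq.2 hq'.2 (by rintro rfl rfl; exact hne rfl)

lemma memLp_radial_normSqDeviation [NeZero d] (h4 : Integrable (fun x ↦ x ^ 4) μ) (i : ℕ) :
    MemLp (fun p ↦ p.1 i ^ 2 * normSqDeviation d (p.2 i)) 2 (radialGaussian μ d) := by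
  rw [memLp_two_iff_integrable_sq (Measurable.aestronglyMeasurable (by fun_prop))]
  have h1 : Integrable (fun r : ℕ → ℝ ↦ r i ^ 4) (Measure.infinitePi fun _ ↦ μ) :=
    (measurePreserving_eval_infinitePi (fun _ : ℕ ↦ μ) i).integrable_comp_of_integrable h4
  have h2 := (measurePreserving_eval_infinitePi (fun _ : ℕ ↦ stdGaussian
    (EuclideanSpace ℝ (Fin d))) i).integrable_comp_of_integrable memLp_normSqDeviation.integrable_sq
  refine (h1.mul_prod h2).congr (ae_of_all _ fun p ↦ ?_)
  simp [mul_pow, ← pow_mul]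

lemma integral_comp_eval_infinitePi {X : Type*} [MeasurableSpace X] (m : Measure X)
    [IsProbabilityMeasure m] {f : X → ℝ} (hf : Measurable f) (i : ℕ) :
    ∫ ω, f (ω i) ∂(Measure.infinitePi fun _ : ℕ ↦ m) = ∫ x, f x ∂m :=
  (identDistrib_eval_infinitePi m hf i).integral_eq

lemma integral_sum_normSqDeviation_sq [NeZero d] (h4 : Integrable (fun x ↦ x ^ 4) μ) (n : ℕ) :
    ∫ p, (∑ i ∈ Finset.range n, p.1 i ^ 2 * normSqDeviation d (p.2 i)) ^ 2 ∂(radialGaussian μ d) =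
      n * ((∫ x, x ^ 4 ∂μ) * (2 / d)) := by
  rw [integral_sum_sq_of_orthogonal _ fun i _ ↦ memLp_radial_normSqDeviation h4 i]
  · simp_rw [mul_pow, ← pow_mul]
    have h (i : ℕ) : ∫ p, p.1 i ^ (2 * 2) * normSqDeviation d (p.2 i) ^ 2 ∂(radialGaussian μ d) =
        (∫ x, x ^ 4 ∂μ) * (2 / d) := by
      rw [radialGaussian, integral_prod_mul (fun r : ℕ → ℝ ↦ r i ^ (2 * 2))
        (fun g : ℕ → EuclideanSpace ℝ (Fin d) ↦ normSqDeviation d (g i) ^ 2),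
        integral_comp_eval_infinitePi μ (f := fun x ↦ x ^ (2 * 2)) (by fun_prop),
        integral_comp_eval_infinitePi _ (f := fun x ↦ normSqDeviation d x ^ 2) (by fun_prop),
        integral_normSqDeviation_sq]
    simp [h]
  · intro i _ j _ hij
    have h0 := integral_prod_mul (μ := Measure.infinitePi fun _ : ℕ ↦ μ)
      (ν := Measure.infinitePi fun _ : ℕ ↦ stdGaussian (EuclideanSpace ℝ (Fin d)))
      (fun r : ℕ → ℝ ↦ r i ^ 2 * r j ^ 2)
      (fun g ↦ normSqDeviation d (g i) * normSqDeviation d (g j))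
    rw [integral_comp_eval_pair (stdGaussian (EuclideanSpace ℝ (Fin d)))
      (f := fun x ↦ normSqDeviation d x.1 * normSqDeviation d x.2) (by fun_prop) hij,
      integral_prod_mul, integral_normSqDeviation, zero_mul, mul_zero] at h0
    rw [← h0, radialGaussian]
    congr with p
    ring

omit [IsProbabilityMeasure μ] in
/-- The squared norm of the walk, up to the two error terms which are negligible. -/
lemma norm_sum_direction_sq [NeZero d] (n : ℕ) :
    ∀ᵐ p ∂(radialGaussian μ d), ‖∑ i ∈ Finset.range n, p.1 i • direction (p.2 i)‖ ^ 2 =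
      ∑ i ∈ Finset.range n, p.1 i ^ 2 +
        (‖∑ i ∈ Finset.range n, p.1 i • p.2 i‖ ^ 2 / d - ∑ i ∈ Finset.range n, p.1 i ^ 2) -
        ∑ i ∈ Finset.range n, p.1 i ^ 2 * normSqDeviation d (p.2 i) +
        2 * ∑ j ∈ Finset.range n, ∑ i ∈ Finset.range j,
          p.1 i * p.1 j * directionKernel d (p.2 i) (p.2 j) := by
  have h0 : ∀ᵐ g ∂(Measure.infinitePi fun _ : ℕ ↦ stdGaussian (EuclideanSpace ℝ (Fin d))),
      ∀ i, g i ≠ 0 := by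
    rw [ae_all_iff]
    exact fun i ↦ (measurePreserving_eval_infinitePi (fun _ : ℕ ↦ stdGaussian
      (EuclideanSpace ℝ (Fin d))) i).quasiMeasurePreserving.ae (ae_ne_zero_stdGaussian d)
  have h1 : ∀ᵐ p ∂(radialGaussian μ d), ∀ i, p.2 i ≠ 0 :=
    Measure.quasiMeasurePreserving_snd.ae h0
  filter_upwards [h1] with p hp
  have hdir (i : ℕ) : ‖direction (p.2 i)‖ = 1 := by simp [direction, norm_smul, hp i]
  rw [norm_sum_range_sq, norm_sum_range_sq]
  have hK : ∑ j ∈ Finset.range n, ∑ i ∈ Finset.range j,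
      p.1 i * p.1 j * directionKernel d (p.2 i) (p.2 j) =
      ∑ j ∈ Finset.range n, ∑ i ∈ Finset.range j,
        inner ℝ (p.1 i • direction (p.2 i)) (p.1 j • direction (p.2 j)) -
      (∑ j ∈ Finset.range n, ∑ i ∈ Finset.range j, inner ℝ (p.1 i • p.2 i) (p.1 j • p.2 j)) / d := by
    simp_rw [Finset.sum_div, ← Finset.sum_sub_distrib]
    refine Finset.sum_congr rfl fun j _ ↦ Finset.sum_congr rfl fun i _ ↦ ?_
    simp only [directionKernel, real_inner_smul_left, real_inner_smul_right]
    ring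
  -- The Gaussian squared norm carries the diagonal `R_i² ‖g_i‖² / d` in place of `R_i²`; this error
  -- term is exactly the discrepancy.
  have hq : ∑ i ∈ Finset.range n, p.1 i ^ 2 * normSqDeviation d (p.2 i) =
      (∑ i ∈ Finset.range n, ‖p.1 i • p.2 i‖ ^ 2) / d - ∑ i ∈ Finset.range n, p.1 i ^ 2 := by
    rw [Finset.sum_div, ← Finset.sum_sub_distrib]
    refine Finset.sum_congr rfl fun i _ ↦ ?_
    rw [normSqDeviation, norm_smul, mul_pow, Real.norm_eq_abs, sq_abs]
    ring
  have h1 : ∑ i ∈ Finset.range n, ‖p.1 i • direction (p.2 i)‖ ^ 2 =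
      ∑ i ∈ Finset.range n, p.1 i ^ 2 := by
    simp [norm_smul, hdir]
  rw [hK, hq, h1]
  ring

/-- Both sides are centred Gaussian with covariance `∑ r_i²` times the identity, as their
characteristic functions show. -/
lemma map_sum_smul_infinitePi_stdGaussian (r : ℕ → ℝ) (n : ℕ) :
    (Measure.infinitePi fun _ : ℕ ↦ stdGaussian (EuclideanSpace ℝ (Fin d))).map
        (fun g ↦ ∑ i ∈ Finset.range n, r i • g i) =
      (stdGaussian (EuclideanSpace ℝ (Fin d))).map
        (fun x ↦ √(∑ i ∈ Finset.range n, r i ^ 2) • x) := by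
  have hind : iIndepFun (fun i (g : ℕ → EuclideanSpace ℝ (Fin d)) ↦ r i • g i)
      (Measure.infinitePi fun _ : ℕ ↦ stdGaussian (EuclideanSpace ℝ (Fin d))) :=
    iIndepFun_infinitePi (X := fun i x ↦ r i • x) (by fun_prop)
  apply Measure.ext_of_charFun
  ext t
  rw [(hind.restrict _).charFun_map_fun_finsetSum_eq_prod fun i _ ↦
    Measurable.aemeasurable (by fun_prop), charFun_map_smul, charFun_stdGaussian,
    Finset.prod_apply]
  have h (i : ℕ) : charFun ((Measure.infinitePi fun _ : ℕ ↦
      stdGaussian (EuclideanSpace ℝ (Fin d))).map fun g ↦ r i • g i) t =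
      Complex.exp (-(r i ^ 2 * ‖t‖ ^ 2 : ℝ) / 2) := by
    rw [(identDistrib_eval_infinitePi (stdGaussian (EuclideanSpace ℝ (Fin d)))
      (f := fun x ↦ r i • x) (by fun_prop) i).map_eq, charFun_map_smul, charFun_stdGaussian,
      norm_smul, ← Complex.ofReal_pow, mul_pow, Real.norm_eq_abs, sq_abs]
  simp_rw [h]
  rw [← Complex.exp_sum, norm_smul, Real.norm_of_nonneg (Real.sqrt_nonneg _)]
  have h2 : ∑ i ∈ Finset.range n, -(r i ^ 2 * ‖t‖ ^ 2) / 2 =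
      -(√(∑ i ∈ Finset.range n, r i ^ 2) * ‖t‖) ^ 2 / 2 := by
    rw [mul_pow, Real.sq_sqrt (by positivity), ← Finset.sum_div, Finset.sum_neg_distrib,
      Finset.sum_mul]
  exact congrArg Complex.exp (by exact_mod_cast h2)

omit [IsProbabilityMeasure μ] in
-- Conditioning on the radii reduces this to deterministic weights. The radii are kept as a first
-- coordinate because `centredSqSum` depends on them as well.
lemma map_norm_sum_smul_sq (n : ℕ) :
    (radialGaussian μ d).map
        (fun p ↦ (p.1, ‖∑ i ∈ Finset.range n, p.1 i • p.2 i‖ ^ 2)) =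
      ((Measure.infinitePi fun _ : ℕ ↦ μ).prod (stdGaussian (EuclideanSpace ℝ (Fin d)))).map
        (fun p ↦ (p.1, (∑ i ∈ Finset.range n, p.1 i ^ 2) * ‖p.2‖ ^ 2)) := by
  ext s hs
  have hm1 : Measurable fun p : (ℕ → ℝ) × (ℕ → EuclideanSpace ℝ (Fin d)) ↦
      (p.1, ‖∑ i ∈ Finset.range n, p.1 i • p.2 i‖ ^ 2) := by fun_prop
  have hm2 : Measurable fun p : (ℕ → ℝ) × EuclideanSpace ℝ (Fin d) ↦
      (p.1, (∑ i ∈ Finset.range n, p.1 i ^ 2) * ‖p.2‖ ^ 2) := by fun_prop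
  rw [Measure.map_apply hm1 hs, Measure.map_apply hm2 hs, radialGaussian,
    Measure.prod_apply (hm1 hs), Measure.prod_apply (hm2 hs)]
  refine lintegral_congr fun r ↦ ?_
  let A : Set (EuclideanSpace ℝ (Fin d)) := {x | (r, ‖x‖ ^ 2) ∈ s}
  have hA : MeasurableSet A :=
    (show Measurable fun x : EuclideanSpace ℝ (Fin d) ↦ (r, ‖x‖ ^ 2) by fun_prop) hs
  have h := congrArg (fun m ↦ m A) (map_sum_smul_infinitePi_stdGaussian (d := d) r n)
  simp only [] at h
  rw [Measure.map_apply (by fun_prop) hA, Measure.map_apply (by fun_prop) hA] at h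
  refine h.trans (congrArg _ ?_)
  ext x
  simp [A, norm_smul, mul_pow, Real.sq_sqrt (Finset.sum_nonneg fun i _ ↦ sq_nonneg (r i))]

end Sequences

/-! ### Comparison with a sum of independent radial and Gaussian parts -/

section Comparison

variable {d : ℕ} {μ : Measure ℝ} [IsProbabilityMeasure μ]

/-- The centred sum of the squares of the first `n` entries of a sequence. -/
def centredSqSum (n : ℕ) (r : ℕ → ℝ) : ℝ := ∑ i ∈ Finset.range n, r i ^ 2 - n

@[fun_prop]
lemma measurable_centredSqSum (n : ℕ) : Measurable (centredSqSum n) := by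
  unfold centredSqSum
  fun_prop

lemma centredSqSum_eq (n : ℕ) (r : ℕ → ℝ) :
    centredSqSum n r = ∑ i ∈ Finset.range n, (r i ^ 2 - 1) := by
  simp [centredSqSum]

lemma memLp_eval_sq_sub_one (h4 : Integrable (fun x ↦ x ^ 4) μ) (i : ℕ) :
    MemLp (fun r : ℕ → ℝ ↦ r i ^ 2 - 1) 2 (Measure.infinitePi fun _ ↦ μ) :=
  (identDistrib_eval_infinitePi μ (f := fun x ↦ x ^ 2 - 1) (by fun_prop) i).memLp_iff.2
    ((memLp_sq_of_integrable_pow_four h4).sub (memLp_const 1))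

lemma memLp_centredSqSum (h4 : Integrable (fun x ↦ x ^ 4) μ) (n : ℕ) :
    MemLp (centredSqSum n) 2 (Measure.infinitePi fun _ ↦ μ) := by
  rw [funext (centredSqSum_eq n)]
  exact memLp_finsetSum _ fun i _ ↦ memLp_eval_sq_sub_one h4 i

omit [IsProbabilityMeasure μ] in
lemma variance_sq_eq_integral (h2 : ∫ x, x ^ 2 ∂μ = 1) :
    Var[fun x ↦ x ^ 2; μ] = ∫ x, (x ^ 2 - 1) ^ 2 ∂μ := by
  rw [variance_eq_integral (by fun_prop), h2]

lemma variance_sq_le : Var[fun x ↦ x ^ 2; μ] ≤ ∫ x, x ^ 4 ∂μ := by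
  refine (variance_le_expectation_sq (by fun_prop)).trans_eq ?_
  simp [← pow_mul]

lemma integral_centredSqSum_sq (h2 : ∫ x, x ^ 2 ∂μ = 1) (h4 : Integrable (fun x ↦ x ^ 4) μ)
    (n : ℕ) :
    ∫ r, centredSqSum n r ^ 2 ∂(Measure.infinitePi fun _ ↦ μ) = n * Var[fun x ↦ x ^ 2; μ] := by
  simp_rw [centredSqSum_eq]
  rw [integral_sum_sq_of_orthogonal _ fun i _ ↦ memLp_eval_sq_sub_one h4 i]
  · simp_rw [fun i ↦ integral_comp_eval_infinitePi μ (f := fun x ↦ (x ^ 2 - 1) ^ 2)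
      (by fun_prop) i, variance_sq_eq_integral h2]
    simp
  · intro i _ j _ hij
    rw [integral_comp_eval_pair μ (f := fun x ↦ (x.1 ^ 2 - 1) * (x.2 ^ 2 - 1)) (by fun_prop) hij,
      integral_prod_mul (fun x : ℝ ↦ x ^ 2 - 1) (fun x ↦ x ^ 2 - 1),
      integral_sub (integrable_sq_of_integrable_pow_four h4) (integrable_const 1), h2]
    simp

/-- Comparison of the walk with the sum of its radial and its Gaussian contribution. -/
lemma norm_charFun_walk_sub_le [NeZero d] (h2 : ∫ x, x ^ 2 ∂μ = 1)
    (h4 : Integrable (fun x ↦ x ^ 4) μ) (n : ℕ) (c t : ℝ) :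
    ‖charFun ((radialGaussian μ d).map
          (fun p ↦ (‖∑ i ∈ Finset.range n, p.1 i • direction (p.2 i)‖ ^ 2 - n) / c)) t -
        charFun ((radialGaussian μ d).map
          (fun p ↦ (centredSqSum n p.1 + (‖∑ i ∈ Finset.range n, p.1 i • p.2 i‖ ^ 2 / d -
            ∑ i ∈ Finset.range n, p.1 i ^ 2)) / c)) t‖ ≤
      |t| * √((4 * n * (∫ x, x ^ 4 ∂μ) / d + 64 * n ^ 2 / d ^ 2) / c ^ 2) := by
  set E₁ : (ℕ → ℝ) × (ℕ → EuclideanSpace ℝ (Fin d)) → ℝ := fun p ↦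
    ∑ i ∈ Finset.range n, p.1 i ^ 2 * normSqDeviation d (p.2 i)
  set E₂ : (ℕ → ℝ) × (ℕ → EuclideanSpace ℝ (Fin d)) → ℝ := fun p ↦
    ∑ j ∈ Finset.range n, ∑ i ∈ Finset.range j, p.1 i * p.1 j * directionKernel d (p.2 i) (p.2 j)
  have hE₁ : MemLp E₁ 2 (radialGaussian μ d) :=
    memLp_finsetSum _ fun i _ ↦ memLp_radial_normSqDeviation h4 i
  have hE₂ : MemLp E₂ 2 (radialGaussian μ d) := memLp_sum_directionKernel h4 n
  have hE : MemLp (fun p ↦ (2 * E₂ p - E₁ p) / c) 2 (radialGaussian μ d) := by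
    simp_rw [div_eq_inv_mul]
    exact ((hE₂.const_mul 2).sub hE₁).const_mul _
  have hae : (fun p ↦ (‖∑ i ∈ Finset.range n, p.1 i • direction (p.2 i)‖ ^ 2 - n) / c -
      (centredSqSum n p.1 + (‖∑ i ∈ Finset.range n, p.1 i • p.2 i‖ ^ 2 / d -
            ∑ i ∈ Finset.range n, p.1 i ^ 2)) / c) =ᵐ[radialGaussian μ d]
      fun p ↦ (2 * E₂ p - E₁ p) / c := by
    filter_upwards [norm_sum_direction_sq (μ := μ) (d := d) n] with p hp
    rw [hp, centredSqSum]
    simp only [E₁, E₂]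
    ring
  refine (norm_charFun_map_sub_le (Measurable.aemeasurable (by fun_prop))
    (Measurable.aemeasurable (by fun_prop)) (hE.ae_eq hae.symm) t).trans ?_
  rw [integral_congr_ae (hae.mono fun p hp ↦ congrArg (· ^ 2) hp)]
  gcongr
  have h1 : ∫ p, E₁ p ^ 2 ∂(radialGaussian μ d) = _ := integral_sum_normSqDeviation_sq h4 n
  have h2 : ∫ p, E₂ p ^ 2 ∂(radialGaussian μ d) ≤ _ := integral_sum_directionKernel_sq_le h2 h4 n
  have hb : Integrable (fun p ↦ 8 * E₂ p ^ 2 + 2 * E₁ p ^ 2) (radialGaussian μ d) :=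
    (hE₂.integrable_sq.const_mul 8).add (hE₁.integrable_sq.const_mul 2)
  simp_rw [div_pow, integral_div]
  gcongr
  -- The inequality `(2a - b)² ≤ 8a² + 2b²` produces the constants `64 = 8 · 8` and `4 = 2 · 2`.
  calc ∫ p, (2 * E₂ p - E₁ p) ^ 2 ∂(radialGaussian μ d)
      ≤ ∫ p, (8 * E₂ p ^ 2 + 2 * E₁ p ^ 2) ∂(radialGaussian μ d) :=
        integral_mono ((hE₂.const_mul 2).sub hE₁).integrable_sq hb fun p ↦ by
          nlinarith [sq_nonneg (2 * E₂ p + E₁ p)]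
    _ = 8 * ∫ p, E₂ p ^ 2 ∂(radialGaussian μ d) + 2 * ∫ p, E₁ p ^ 2 ∂(radialGaussian μ d) := by
        rw [integral_add (hE₂.integrable_sq.const_mul 8) (hE₁.integrable_sq.const_mul 2),
          integral_const_mul, integral_const_mul]
    _ ≤ 8 * (n ^ 2 * (8 / d ^ 2)) + 2 * (n * ((∫ x, x ^ 4 ∂μ) * (2 / d))) := by
        rw [h1]
        gcongr
    _ = _ := by ring

omit [IsProbabilityMeasure μ] in
lemma map_centredSqSum_add (n : ℕ) (c : ℝ) :
    (radialGaussian μ d).map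
        (fun p ↦ (centredSqSum n p.1 + (‖∑ i ∈ Finset.range n, p.1 i • p.2 i‖ ^ 2 / d -
          ∑ i ∈ Finset.range n, p.1 i ^ 2)) / c) =
      ((Measure.infinitePi fun _ : ℕ ↦ μ).prod (stdGaussian (EuclideanSpace ℝ (Fin d)))).map
        (fun p ↦ (centredSqSum n p.1 + (∑ i ∈ Finset.range n, p.1 i ^ 2) *
          normSqDeviation d p.2) / c) := by
  have h := congrArg (Measure.map fun q : (ℕ → ℝ) × ℝ ↦
    (centredSqSum n q.1 + (q.2 / d - ∑ i ∈ Finset.range n, q.1 i ^ 2)) / c)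
    (map_norm_sum_smul_sq (μ := μ) (d := d) n)
  rw [Measure.map_map (by fun_prop) (by fun_prop), Measure.map_map (by fun_prop) (by fun_prop)] at h
  refine h.trans (congrArg (fun f ↦ Measure.map f _) (funext fun p ↦ ?_))
  simp only [Function.comp, normSqDeviation]
  ring

/-- The difference is a product of two independent factors over `c`, with second moment `n Var(R²)
(2 / d) / c²`. It is weakened to the bound of `norm_charFun_walk_sub_le` so that the two errors
simply add. -/
lemma norm_charFun_centredSqSum_add_sub_le [NeZero d] (h2 : ∫ x, x ^ 2 ∂μ = 1)
    (h4 : Integrable (fun x ↦ x ^ 4) μ) (n : ℕ) (c t : ℝ) :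
    ‖charFun (((Measure.infinitePi fun _ : ℕ ↦ μ).prod (stdGaussian
          (EuclideanSpace ℝ (Fin d)))).map (fun p ↦ (centredSqSum n p.1 +
            (∑ i ∈ Finset.range n, p.1 i ^ 2) * normSqDeviation d p.2) / c)) t -
        charFun (((Measure.infinitePi fun _ : ℕ ↦ μ).prod (stdGaussian
          (EuclideanSpace ℝ (Fin d)))).map (fun p ↦ (centredSqSum n p.1 +
            n * normSqDeviation d p.2) / c)) t‖ ≤
      |t| * √((4 * n * (∫ x, x ^ 4 ∂μ) / d + 64 * n ^ 2 / d ^ 2) / c ^ 2) := by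
  have hae (p : (ℕ → ℝ) × EuclideanSpace ℝ (Fin d)) : (centredSqSum n p.1 +
            (∑ i ∈ Finset.range n, p.1 i ^ 2) * normSqDeviation d p.2) / c - (centredSqSum n p.1 +
            n * normSqDeviation d p.2) / c =
      c⁻¹ * (centredSqSum n p.1 * normSqDeviation d p.2) := by
    rw [centredSqSum]
    ring
  have hL : MemLp (fun p : (ℕ → ℝ) × EuclideanSpace ℝ (Fin d) ↦
      centredSqSum n p.1 * normSqDeviation d p.2) 2
      ((Measure.infinitePi fun _ : ℕ ↦ μ).prod (stdGaussian (EuclideanSpace ℝ (Fin d)))) := by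
    rw [memLp_two_iff_integrable_sq (Measurable.aestronglyMeasurable (by fun_prop))]
    simp_rw [mul_pow]
    exact (memLp_centredSqSum h4 n).integrable_sq.mul_prod memLp_normSqDeviation.integrable_sq
  refine (norm_charFun_map_sub_le (Measurable.aemeasurable (by fun_prop))
    (Measurable.aemeasurable (by fun_prop)) (by simp_rw [hae]; exact hL.const_mul _) t).trans ?_
  simp_rw [hae, mul_pow, integral_const_mul]
  rw [integral_prod_mul (fun r ↦ centredSqSum n r ^ 2)
    (fun x : EuclideanSpace ℝ (Fin d) ↦ normSqDeviation d x ^ 2), integral_normSqDeviation_sq,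
    integral_centredSqSum_sq h2 h4, inv_pow, inv_mul_eq_div]
  gcongr
  have hv := variance_sq_le (μ := μ)
  have h0 := variance_nonneg (fun x ↦ x ^ 2) μ
  calc n * Var[fun x ↦ x ^ 2; μ] * (2 / d) ≤ n * (∫ x, x ^ 4 ∂μ) * (4 / d) := by
        gcongr
        norm_num
    _ = 4 * n * (∫ x, x ^ 4 ∂μ) / d := by ring
    _ ≤ _ := le_add_of_nonneg_right (by positivity)

lemma charFun_centredSqSum_add_eq_mul [NeZero d] (n : ℕ) (c t : ℝ) :
    charFun (((Measure.infinitePi fun _ : ℕ ↦ μ).prod (stdGaussian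
        (EuclideanSpace ℝ (Fin d)))).map (fun p ↦ (centredSqSum n p.1 +
          n * normSqDeviation d p.2) / c)) t =
      charFun ((Measure.infinitePi fun _ : ℕ ↦ μ).map (centredSqSum n)) (t / c) *
        charFun ((stdGaussian (EuclideanSpace ℝ (Fin d))).map (normalizedNormSq d))
          (t * (n * √(2 / d) / c)) := by
  simp only [charFun_apply_real]
  rw [integral_map (Measurable.aemeasurable (by fun_prop)) (by fun_prop),
    integral_map (Measurable.aemeasurable (by fun_prop)) (by fun_prop),
    integral_map (Measurable.aemeasurable (by fun_prop)) (by fun_prop), ← integral_prod_mul]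
  congr with p
  rw [← Complex.exp_add, normSqDeviation_eq]
  congr 1
  push_cast
  ring

lemma norm_charFun_walk_sub_mul_le [NeZero d] (h2 : ∫ x, x ^ 2 ∂μ = 1)
    (h4 : Integrable (fun x ↦ x ^ 4) μ) (n : ℕ) (c t : ℝ) :
    ‖charFun ((radialGaussian μ d).map
          (fun p ↦ (‖∑ i ∈ Finset.range n, p.1 i • direction (p.2 i)‖ ^ 2 - n) / c)) t -
        charFun ((Measure.infinitePi fun _ : ℕ ↦ μ).map (centredSqSum n)) (t / c) *
          charFun ((stdGaussian (EuclideanSpace ℝ (Fin d))).map (normalizedNormSq d))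
            (t * (n * √(2 / d) / c))‖ ≤
      2 * |t| * √((4 * n * (∫ x, x ^ 4 ∂μ) / d + 64 * n ^ 2 / d ^ 2) / c ^ 2) := by
  have h1 := norm_charFun_walk_sub_le (d := d) h2 h4 n c t
  have h3 := norm_charFun_centredSqSum_add_sub_le (d := d) h2 h4 n c t
  rw [map_centredSqSum_add] at h1
  rw [charFun_centredSqSum_add_eq_mul] at h3
  refine (norm_sub_le_norm_sub_add_norm_sub _ _ _).trans ((add_le_add h1 h3).trans_eq ?_)
  ring

lemma tendsto_charFun_centredSqSum (h2 : ∫ x, x ^ 2 ∂μ = 1) (h4 : Integrable (fun x ↦ x ^ 4) μ)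
    (t : ℝ) :
    Tendsto (fun n : ℕ ↦ charFun ((Measure.infinitePi fun _ : ℕ ↦ μ).map (centredSqSum n))
        (t / √n)) atTop
      (𝓝 (charFun (gaussianReal 0 Var[fun x ↦ x ^ 2; μ].toNNReal) t)) := by
  have hm (i : ℕ) := identDistrib_eval_infinitePi μ (f := fun x ↦ x ^ 2) (by fun_prop) i
  have h := tendstoInDistribution_inv_sqrt_mul_sum_sub (P := Measure.infinitePi fun _ : ℕ ↦ μ)
    (X := fun i ω ↦ ω i ^ 2) (Y := id) HasLaw.id
    ((hm 0).memLp_iff.2 (memLp_sq_of_integrable_pow_four h4))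
    (iIndepFun_infinitePi (X := fun _ x ↦ x ^ 2) (by fun_prop))
    fun i ↦ (hm i).trans (hm 0).symm
  have := ProbabilityMeasure.tendsto_iff_tendsto_charFun.1 h.tendsto t
  simp only [ProbabilityMeasure.coe_mk, Measure.map_id, (hm 0).integral_eq, h2, mul_one,
    (hm 0).variance_eq] at this
  refine this.congr fun n ↦ ?_
  rw [div_eq_inv_mul, ← charFun_map_mul, Measure.map_map (by fun_prop) (by fun_prop)]
  rfl

/-- Comparison with the constant `0`. This disposes of the radial part when the normalization
dominates its standard deviation. -/
lemma norm_charFun_centredSqSum_sub_one_le (h2 : ∫ x, x ^ 2 ∂μ = 1)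
    (h4 : Integrable (fun x ↦ x ^ 4) μ) (n : ℕ) (t : ℝ) :
    ‖charFun ((Measure.infinitePi fun _ : ℕ ↦ μ).map (centredSqSum n)) t - 1‖ ≤
      |t| * √(n * Var[fun x ↦ x ^ 2; μ]) := by
  have h := norm_charFun_map_sub_le (P := Measure.infinitePi fun _ : ℕ ↦ μ)
    (A := centredSqSum n) (B := fun _ ↦ 0) (Measurable.aemeasurable (by fun_prop)) (by fun_prop)
    (by simpa using memLp_centredSqSum h4 n) t
  simpa [integral_centredSqSum_sq h2 h4] using h

end Comparison

/-! ### Transfer to the given walk and passage to the limit -/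

section Limit

/-- Only laws matter for the conclusion, so the Gaussian vectors need not live on the original
probability space. -/
lemma IsRadialDirectional.map_eq {Ω₀ Ω : Type*} [MeasurableSpace Ω₀] [MeasurableSpace Ω]
    {P₀ : Measure Ω₀} {P : Measure Ω} [IsProbabilityMeasure P₀] [IsProbabilityMeasure P] {d : ℕ}
    [NeZero d] {R₀ : Ω₀ → ℝ} {R : ℕ → Ω → ℝ} {U : ℕ → Ω → EuclideanSpace ℝ (Fin d)}
    (h : IsRadialDirectional P₀ P d R₀ R U) :
    P.map (fun ω ↦ (fun i ↦ R i ω, fun i ↦ U i ω)) =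
      (radialGaussian (P₀.map R₀) d).map (fun p ↦ (p.1, fun i ↦ direction (p.2 i))) := by
  have hR (i : ℕ) : AEMeasurable (R i) P := (h.radial_copy i).aemeasurable_fst
  have hU (i : ℕ) : AEMeasurable (U i) P := (h.direction_law i).aemeasurable
  have := Measure.isProbabilityMeasure_map (μ := P₀) (h.radial_copy 0).aemeasurable_snd
  have hdir : P.map (fun ω i ↦ U i ω) = (Measure.infinitePi fun _ : ℕ ↦
      stdGaussian (EuclideanSpace ℝ (Fin d))).map (fun g i ↦ direction (g i)) := by
    rw [h.direction_indep.map_fun_eq_infinitePi_map₀' hU,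
      Measure.infinitePi_map_pi _ fun _ ↦ measurable_direction, stdGaussian_map_direction]
    exact congrArg _ (funext fun i ↦ (h.direction_law i).map_eq)
  have hrad : P.map (fun ω i ↦ R i ω) = Measure.infinitePi fun _ : ℕ ↦ P₀.map R₀ := by
    rw [h.radial_indep.map_fun_eq_infinitePi_map₀' hR]
    exact congrArg _ (funext fun i ↦ (h.radial_copy i).map_eq)
  rw [(indepFun_iff_map_prod_eq_prod_map_map (aemeasurable_pi_iff.2 hR)
    (aemeasurable_pi_iff.2 hU)).1 h.radial_indep_direction, hrad, hdir, radialGaussian]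
  conv_lhs => rw [← Measure.map_id (μ := Measure.infinitePi fun _ : ℕ ↦ P₀.map R₀)]
  rw [Measure.map_prod_map _ _ measurable_id (by fun_prop)]
  rfl

variable {Ω₀ Ω : Type*} [MeasurableSpace Ω₀] [MeasurableSpace Ω]
  {P₀ : Measure Ω₀} {P : Measure Ω} [IsProbabilityMeasure P₀] [IsProbabilityMeasure P] {d : ℕ}
  {R₀ : Ω₀ → ℝ} {R : ℕ → Ω → ℝ} {U : ℕ → Ω → EuclideanSpace ℝ (Fin d)}

omit [IsProbabilityMeasure P₀] [IsProbabilityMeasure P] in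
lemma IsRadialDirectional.aemeasurable_radialWalk (h : IsRadialDirectional P₀ P d R₀ R U) (n : ℕ) :
    AEMeasurable (radialWalk R U n) P :=
  Finset.aemeasurable_fun_sum _ fun i _ ↦
    (h.radial_copy i).aemeasurable_fst.smul (h.direction_law i).aemeasurable

lemma IsRadialDirectional.map_norm_radialWalk_sq [NeZero d]
    (h : IsRadialDirectional P₀ P d R₀ R U) (n : ℕ) (c : ℝ) :
    P.map (fun ω ↦ (‖radialWalk R U n ω‖ ^ 2 - n) / c) =
      (radialGaussian (P₀.map R₀) d).map
        (fun p ↦ (‖∑ i ∈ Finset.range n, p.1 i • direction (p.2 i)‖ ^ 2 - n) / c) := by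
  have hR (i : ℕ) : AEMeasurable (R i) P := (h.radial_copy i).aemeasurable_fst
  have hU (i : ℕ) : AEMeasurable (U i) P := (h.direction_law i).aemeasurable
  have e := congrArg (Measure.map fun p : (ℕ → ℝ) × (ℕ → EuclideanSpace ℝ (Fin d)) ↦
    (‖∑ i ∈ Finset.range n, p.1 i • p.2 i‖ ^ 2 - n) / c) h.map_eq
  rwa [AEMeasurable.map_map_of_aemeasurable (Measurable.aemeasurable (by fun_prop))
    ((aemeasurable_pi_iff.2 hR).prodMk (aemeasurable_pi_iff.2 hU)),
    Measure.map_map (by fun_prop) (by fun_prop)] at e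

lemma ProbabilityMeasure.tendsto_of_tendsto_charFun_pnat {μ : ℕ+ → ProbabilityMeasure ℝ}
    {μ₀ : ProbabilityMeasure ℝ}
    (h : ∀ t, Tendsto (fun d ↦ charFun (μ d : Measure ℝ) t) atTop (𝓝 (charFun μ₀ t))) :
    Tendsto μ atTop (𝓝 μ₀) := by
  rw [← OrderIso.pnatIsoNat.symm.map_atTop, tendsto_map'_iff]
  exact ProbabilityMeasure.tendsto_of_tendsto_charFun fun t ↦
    (h t).comp OrderIso.pnatIsoNat.symm.tendsto_atTop

lemma tendstoInDistribution_of_tendsto_charFun {Ω : ℕ+ → Type*} [∀ d, MeasurableSpace (Ω d)]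
    {P : (d : ℕ+) → Measure (Ω d)} [∀ d, IsProbabilityMeasure (P d)] {X : (d : ℕ+) → Ω d → ℝ}
    (hX : ∀ d, AEMeasurable (X d) (P d)) {ρ : Measure ℝ} [IsProbabilityMeasure ρ]
    (h : ∀ t, Tendsto (fun d ↦ charFun ((P d).map (X d)) t) atTop (𝓝 (charFun ρ t))) :
    TendstoInDistribution X atTop id P ρ where
  forall_aemeasurable := hX
  tendsto := ProbabilityMeasure.tendsto_of_tendsto_charFun_pnat fun t ↦ by
    simpa using h t

lemma variance_sq_eq_zero_of_isAlmostSurelyConst (h : IsAlmostSurelyConst R₀ P₀) :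
    Var[fun ω ↦ R₀ ω ^ 2; P₀] = 0 := by
  obtain ⟨c, hc⟩ := h
  rw [variance_congr (Y := fun _ ↦ c ^ 2) (hc.mono fun ω hω ↦ by simp [hω])]
  rw [variance_eq_integral (by fun_prop)]
  simp

lemma tendsto_PNat_cast_atTop : Tendsto (fun d : ℕ+ ↦ ((d : ℕ) : ℝ)) atTop atTop :=
  tendsto_natCast_atTop_atTop.comp tendsto_PNat_val_atTop_atTop

/-- The argument varies with `d`. Since all second moments equal `1`, the characteristic functions
are Lipschitz uniformly in `d`, and pointwise convergence suffices. -/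
lemma tendsto_charFun_normalizedNormSq_of_tendsto {s : ℕ+ → ℝ} {t : ℝ}
    (hs : Tendsto s atTop (𝓝 t)) :
    Tendsto (fun d : ℕ+ ↦ charFun
      ((stdGaussian (EuclideanSpace ℝ (Fin d))).map (normalizedNormSq d)) (s d)) atTop
      (𝓝 (charFun (gaussianReal 0 1) t)) := by
  have h := (tendsto_charFun_normalizedNormSq t).comp tendsto_PNat_val_atTop_atTop
  have h0 : Tendsto (fun d : ℕ+ ↦ charFun
      ((stdGaussian (EuclideanSpace ℝ (Fin d))).map (normalizedNormSq d)) (s d) - charFun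
      ((stdGaussian (EuclideanSpace ℝ (Fin d))).map (normalizedNormSq d)) t) atTop (𝓝 0) := by
    refine squeeze_zero_norm (a := fun d ↦ |s d - t|) (fun d ↦ ?_) ?_
    · have := Measure.isProbabilityMeasure_map (μ := stdGaussian (EuclideanSpace ℝ (Fin d)))
        (f := normalizedNormSq d) (by fun_prop)
      have hL : MemLp id 2 ((stdGaussian (EuclideanSpace ℝ (Fin d))).map (normalizedNormSq d)) := by
        rw [memLp_map_measure_iff (by fun_prop) (by fun_prop)]
        exact memLp_normalizedNormSq d
      refine (norm_charFun_sub_charFun_le hL (s d) t).trans_eq ?_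
      rw [integral_map (by fun_prop) (by fun_prop), integral_normalizedNormSq_sq d.pos]
      simp
    · simpa using (hs.sub_const t).abs
  simpa using h0.add h

/-! ### The limit regimes -/

section Main

variable {Ω : ℕ+ → Type*} [∀ d, MeasurableSpace (Ω d)] {P : (d : ℕ+) → Measure (Ω d)}
  [∀ d, IsProbabilityMeasure (P d)] {R : (d : ℕ+) → ℕ → Ω d → ℝ}
  {U : (d : ℕ+) → ℕ → Ω d → EuclideanSpace ℝ (Fin (d : ℕ))}

/-- The characteristic function of the normalized walk has the same limit as the product of those
of its radial and its Gaussian contribution. -/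
lemma tendstoInDistribution_walk (hR_two : ∫ ω, R₀ ω ^ 2 ∂P₀ = 1)
    (hR_four : Integrable (fun ω ↦ R₀ ω ^ 4) P₀)
    (hRU : ∀ d : ℕ+, IsRadialDirectional P₀ (P d) (d : ℕ) R₀ (R d) (U d)) (n : ℕ+ → ℕ)
    (c : ℕ+ → ℝ) {ρ : Measure ℝ} [IsProbabilityMeasure ρ]
    (herr : Tendsto (fun d : ℕ+ ↦ (4 * n d * (∫ ω, R₀ ω ^ 4 ∂P₀) / (d : ℕ) +
      64 * n d ^ 2 / (d : ℕ) ^ 2) / c d ^ 2) atTop (𝓝 0))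
    (hlim : ∀ t, Tendsto (fun d : ℕ+ ↦ charFun ((Measure.infinitePi fun _ : ℕ ↦ P₀.map R₀).map
        (centredSqSum (n d))) (t / c d) *
      charFun ((stdGaussian (EuclideanSpace ℝ (Fin d))).map (normalizedNormSq d))
        (t * (n d * √(2 / (d : ℕ)) / c d))) atTop (𝓝 (charFun ρ t))) :
    TendstoInDistribution
      (fun (d : ℕ+) (ω : Ω d) ↦ (‖radialWalk (R d) (U d) (n d) ω‖ ^ 2 - (n d : ℝ)) / c d)
      atTop id P ρ := by
  have hR₀ : AEMeasurable R₀ P₀ := ((hRU 1).radial_copy 0).aemeasurable_snd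
  have := Measure.isProbabilityMeasure_map hR₀
  have h2 : ∫ x, x ^ 2 ∂(P₀.map R₀) = 1 := by rw [integral_map hR₀ (by fun_prop), hR_two]
  have h4 : Integrable (fun x ↦ x ^ 4) (P₀.map R₀) :=
    (integrable_map_measure (by fun_prop) hR₀).2 hR_four
  have hm4 : ∫ x, x ^ 4 ∂(P₀.map R₀) = ∫ ω, R₀ ω ^ 4 ∂P₀ := integral_map hR₀ (by fun_prop)
  refine tendstoInDistribution_of_tendsto_charFun
    (fun d ↦ ((((hRU d).aemeasurable_radialWalk _).norm.pow_const 2).sub_const _).div_const _)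
    fun t ↦ ?_
  have h0 := squeeze_zero_norm (fun d : ℕ+ ↦
    norm_charFun_walk_sub_mul_le (d := d) h2 h4 (n d) (c d) t)
    (by simpa [hm4] using (herr.sqrt).const_mul (2 * |t|))
  refine (by simpa using h0.add (hlim t) : Tendsto _ _ _).congr fun d ↦ ?_
  rw [(hRU d).map_norm_radialWalk_sq]

/-- The common form of the first and the third regime. -/
lemma tendstoInDistribution_walk_of_tendsto_ratio (hR_two : ∫ ω, R₀ ω ^ 2 ∂P₀ = 1)
    (hR_four : Integrable (fun ω ↦ R₀ ω ^ 4) P₀)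
    (hRU : ∀ d : ℕ+, IsRadialDirectional P₀ (P d) (d : ℕ) R₀ (R d) (U d)) {n : ℕ+ → ℕ}
    (hn_pos : ∀ d, 0 < n d) (hn : Tendsto n atTop atTop) {γ : ℝ}
    (hγ : Tendsto (fun d : ℕ+ ↦ (n d : ℝ) / ((d : ℕ) : ℝ)) atTop (𝓝 γ)) :
    TendstoInDistribution
      (fun (d : ℕ+) (ω : Ω d) ↦
        (‖radialWalk (R d) (U d) (n d) ω‖ ^ 2 - (n d : ℝ)) / √(n d : ℝ))
      atTop id P (gaussianReal 0 (2 * γ + Var[fun ω ↦ R₀ ω ^ 2; P₀]).toNNReal) := by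
  have hR₀ : AEMeasurable R₀ P₀ := ((hRU 1).radial_copy 0).aemeasurable_snd
  have := Measure.isProbabilityMeasure_map hR₀
  have h2 : ∫ x, x ^ 2 ∂(P₀.map R₀) = 1 := by rw [integral_map hR₀ (by fun_prop), hR_two]
  have h4 : Integrable (fun x ↦ x ^ 4) (P₀.map R₀) :=
    (integrable_map_measure (by fun_prop) hR₀).2 hR_four
  have hV : Var[fun x ↦ x ^ 2; P₀.map R₀] = Var[fun ω ↦ R₀ ω ^ 2; P₀] :=
    variance_map (by fun_prop) hR₀
  have hγ0 : 0 ≤ γ := ge_of_tendsto' hγ fun d ↦ by positivity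
  have hn' (d : ℕ+) : (0 : ℝ) < n d := by exact_mod_cast hn_pos d
  have hd' (d : ℕ+) : (0 : ℝ) < (d : ℕ) := by exact_mod_cast d.pos
  have hinv : Tendsto (fun d : ℕ+ ↦ (((d : ℕ) : ℝ))⁻¹) atTop (𝓝 0) :=
    tendsto_inv_atTop_zero.comp tendsto_PNat_cast_atTop
  refine tendstoInDistribution_walk hR_two hR_four hRU n _ ?_ fun t ↦ ?_
  -- Dividing by `c² = n` leaves `4 E R⁴ / d + 64 (n / d) / d`.
  · have := (hinv.const_mul (4 * ∫ ω, R₀ ω ^ 4 ∂P₀)).add ((hγ.mul hinv).const_mul 64)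
    simp only [mul_zero, add_zero] at this
    refine this.congr fun d ↦ ?_
    have := hn' d
    have := hd' d
    rw [Real.sq_sqrt (hn' d).le]
    field_simp
  · have e1 := (tendsto_charFun_centredSqSum h2 h4 t).comp hn
    -- The Gaussian part has coefficient `√(2 n / d)`.
    have e2 : Tendsto (fun d : ℕ+ ↦ t * (n d * √(2 / (d : ℕ)) / √(n d : ℝ))) atTop
        (𝓝 (t * √(2 * γ))) := by
      refine ((hγ.const_mul 2).sqrt.const_mul t).congr fun d ↦ ?_
      have := Real.sqrt_pos.2 (hn' d)
      have e : (n d : ℝ) = √(n d : ℝ) * √(n d : ℝ) := (Real.mul_self_sqrt (hn' d).le).symm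
      rw [mul_div_assoc', mul_comm 2, mul_div_assoc, Real.sqrt_mul (hn' d).le]
      congr 1
      rw [eq_div_iff this.ne', mul_right_comm, ← e]
    have e3 : charFun (gaussianReal 0 (2 * γ + Var[fun ω ↦ R₀ ω ^ 2; P₀]).toNNReal) t =
        charFun (gaussianReal 0 Var[fun x ↦ x ^ 2; P₀.map R₀].toNNReal) t *
          charFun (gaussianReal 0 1) (t * √(2 * γ)) := by
      have hs : (t * √(2 * γ)) ^ 2 = 2 * γ * t ^ 2 := by
        rw [mul_pow, Real.sq_sqrt (by positivity)]
        ring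
      have hV0 := variance_nonneg (fun ω ↦ R₀ ω ^ 2) P₀
      rw [charFun_gaussianReal, charFun_gaussianReal, charFun_gaussianReal, ← Complex.exp_add, hV,
        Real.coe_toNNReal _ hV0, Real.coe_toNNReal _ (by positivity), ← Complex.ofReal_pow (_ * _),
        hs]
      congr 1
      push_cast
      ring
    rw [e3]
    exact e1.mul (tendsto_charFun_normalizedNormSq_of_tendsto e2)

/-- Here `c = n √(2 / d)` gives the Gaussian part coefficient exactly `1`, while the radial part has
second moment `Var(R²) d / (2 n)`. This tends to `0` if `n / d → ∞` and vanishes if `R` is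
deterministic. -/
lemma tendstoInDistribution_walk_of_dominant_direction (hR_two : ∫ ω, R₀ ω ^ 2 ∂P₀ = 1)
    (hR_four : Integrable (fun ω ↦ R₀ ω ^ 4) P₀)
    (hRU : ∀ d : ℕ+, IsRadialDirectional P₀ (P d) (d : ℕ) R₀ (R d) (U d)) {n : ℕ+ → ℕ}
    (hn_pos : ∀ d, 0 < n d) (hn : Tendsto n atTop atTop)
    (h : Tendsto (fun d : ℕ+ ↦ (n d : ℝ) / ((d : ℕ) : ℝ)) atTop atTop ∨
      IsAlmostSurelyConst R₀ P₀) :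
    TendstoInDistribution
      (fun (d : ℕ+) (ω : Ω d) ↦ (‖radialWalk (R d) (U d) (n d) ω‖ ^ 2 - (n d : ℝ)) /
        √(2 * (n d : ℝ) ^ 2 / ((d : ℕ) : ℝ)))
      atTop id P (gaussianReal 0 1) := by
  have hR₀ : AEMeasurable R₀ P₀ := ((hRU 1).radial_copy 0).aemeasurable_snd
  have := Measure.isProbabilityMeasure_map hR₀
  have h2 : ∫ x, x ^ 2 ∂(P₀.map R₀) = 1 := by rw [integral_map hR₀ (by fun_prop), hR_two]
  have h4 : Integrable (fun x ↦ x ^ 4) (P₀.map R₀) :=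
    (integrable_map_measure (by fun_prop) hR₀).2 hR_four
  have hV : Var[fun x ↦ x ^ 2; P₀.map R₀] = Var[fun ω ↦ R₀ ω ^ 2; P₀] :=
    variance_map (by fun_prop) hR₀
  have hn' (d : ℕ+) : (0 : ℝ) < n d := by exact_mod_cast hn_pos d
  have hd' (d : ℕ+) : (0 : ℝ) < (d : ℕ) := by exact_mod_cast d.pos
  have hinv : Tendsto (fun d : ℕ+ ↦ (((d : ℕ) : ℝ))⁻¹) atTop (𝓝 0) :=
    tendsto_inv_atTop_zero.comp tendsto_PNat_cast_atTop
  have hninv : Tendsto (fun d : ℕ+ ↦ ((n d : ℝ))⁻¹) atTop (𝓝 0) :=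
    tendsto_inv_atTop_zero.comp (tendsto_natCast_atTop_atTop.comp hn)
  refine tendstoInDistribution_walk hR_two hR_four hRU n _ ?_ fun t ↦ ?_
  -- Dividing by `c² = 2 n² / d` leaves `2 E R⁴ / n + 32 / d`.
  · have := (hninv.const_mul (2 * ∫ ω, R₀ ω ^ 4 ∂P₀)).add (hinv.const_mul 32)
    simp only [mul_zero, add_zero] at this
    refine this.congr fun d ↦ ?_
    have := hn' d
    have := hd' d
    rw [Real.sq_sqrt (by positivity)]
    field_simp
    ring
  · have hratio : Tendsto (fun d : ℕ+ ↦ Var[fun ω ↦ R₀ ω ^ 2; P₀] / 2 * ((n d : ℝ) / (d : ℕ))⁻¹)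
        atTop (𝓝 0) := by
      rcases h with h | h
      · simpa using (tendsto_inv_atTop_zero.comp h).const_mul (Var[fun ω ↦ R₀ ω ^ 2; P₀] / 2)
      · simp [variance_sq_eq_zero_of_isAlmostSurelyConst h]
    have e1 : Tendsto (fun d : ℕ+ ↦ charFun ((Measure.infinitePi fun _ : ℕ ↦ P₀.map R₀).map
        (centredSqSum (n d))) (t / √(2 * (n d : ℝ) ^ 2 / ((d : ℕ) : ℝ))) - 1) atTop (𝓝 0) := by
      refine squeeze_zero_norm (fun d ↦ norm_charFun_centredSqSum_sub_one_le h2 h4 (n d) _) ?_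
      have := hratio.sqrt.const_mul |t|
      rw [Real.sqrt_zero, mul_zero] at this
      refine this.congr fun d ↦ ?_
      have := hn' d
      have := hd' d
      have hs : Var[fun ω ↦ R₀ ω ^ 2; P₀] / 2 * ((n d : ℝ) / (d : ℕ))⁻¹ =
          (n d * Var[fun ω ↦ R₀ ω ^ 2; P₀]) / (2 * (n d : ℝ) ^ 2 / ((d : ℕ) : ℝ)) := by
        field_simp
      rw [abs_div, abs_of_nonneg (Real.sqrt_nonneg _), hV, hs, Real.sqrt_div' _ (by positivity)]
      ring
    have e2 : Tendsto (fun d : ℕ+ ↦ t * (n d * √(2 / (d : ℕ)) /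
        √(2 * (n d : ℝ) ^ 2 / ((d : ℕ) : ℝ)))) atTop (𝓝 t) := by
      refine tendsto_const_nhds.congr fun d ↦ ?_
      have := hn' d
      have := hd' d
      have hs : √(2 * (n d : ℝ) ^ 2 / ((d : ℕ) : ℝ)) = n d * √(2 / (d : ℕ)) := by
        rw [mul_comm 2, mul_div_assoc, Real.sqrt_mul (by positivity), Real.sqrt_sq (hn' d).le]
      rw [hs, div_self (by positivity), mul_one]
    simpa using (e1.add_const 1).mul (tendsto_charFun_normalizedNormSq_of_tendsto e2)

end Main

end Limit

theorem mainTheorem9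
    {Ω₀ : Type*} [MeasurableSpace Ω₀] (P₀ : Measure Ω₀) [IsProbabilityMeasure P₀]
    (R₀ : Ω₀ → ℝ) (hR_nonneg : ∀ᵐ ω ∂P₀, 0 ≤ R₀ ω)
    (hR_two : ∫ ω, R₀ ω ^ 2 ∂P₀ = 1) (hR_four : Integrable (fun ω ↦ R₀ ω ^ 4) P₀)
    {Ω : ℕ+ → Type*} [∀ d, MeasurableSpace (Ω d)]
    (P : (d : ℕ+) → Measure (Ω d)) [∀ d, IsProbabilityMeasure (P d)]
    (R : (d : ℕ+) → ℕ → Ω d → ℝ)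
    (U : (d : ℕ+) → ℕ → Ω d → EuclideanSpace ℝ (Fin (d : ℕ)))
    (hRU : ∀ d : ℕ+, IsRadialDirectional P₀ (P d) (d : ℕ) R₀ (R d) (U d))
    (n : ℕ+ → ℕ) (hn_pos : ∀ d, 0 < n d) (hn : Tendsto n atTop atTop) :
    (Tendsto (fun d : ℕ+ ↦ (n d : ℝ) / ((d : ℕ) : ℝ)) atTop (𝓝 0) → ¬ IsAlmostSurelyConst R₀ P₀ →
      TendstoInDistribution
        (fun (d : ℕ+) (ω : Ω d) ↦
          (‖radialWalk (R d) (U d) (n d) ω‖ ^ 2 - (n d : ℝ)) / √(n d : ℝ))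
        atTop id P (gaussianReal 0 (Var[fun ω ↦ R₀ ω ^ 2; P₀]).toNNReal)) ∧
    (Tendsto (fun d : ℕ+ ↦ (n d : ℝ) / ((d : ℕ) : ℝ)) atTop atTop ∨ IsAlmostSurelyConst R₀ P₀ →
      TendstoInDistribution
        (fun (d : ℕ+) (ω : Ω d) ↦
          (‖radialWalk (R d) (U d) (n d) ω‖ ^ 2 - (n d : ℝ)) /
            √(2 * (n d : ℝ) ^ 2 / ((d : ℕ) : ℝ)))
        atTop id P (gaussianReal 0 1)) ∧
    (∀ γ : ℝ, 0 < γ →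
      (fun d : ℕ+ ↦ (n d : ℝ)) ~[atTop] (fun d : ℕ+ ↦ γ * ((d : ℕ) : ℝ)) →
      TendstoInDistribution
        (fun (d : ℕ+) (ω : Ω d) ↦
          (‖radialWalk (R d) (U d) (n d) ω‖ ^ 2 - (n d : ℝ)) / √(n d : ℝ))
        atTop id P (gaussianReal 0 (2 * γ + Var[fun ω ↦ R₀ ω ^ 2; P₀]).toNNReal)) := by
  refine ⟨fun hratio _ ↦ ?_, tendstoInDistribution_walk_of_dominant_direction hR_two hR_four hRU
    hn_pos hn, fun γ hγ h ↦ ?_⟩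
  -- The first regime is the case `γ = 0` of the third.
  · simpa using tendstoInDistribution_walk_of_tendsto_ratio hR_two hR_four hRU hn_pos hn hratio
  · refine tendstoInDistribution_walk_of_tendsto_ratio hR_two hR_four hRU hn_pos hn ?_
    have hd (d : ℕ+) : ((d : ℕ) : ℝ) ≠ 0 := by exact_mod_cast d.ne_zero
    have h1 := ((isEquivalent_iff_tendsto_one
      (Eventually.of_forall fun d ↦ mul_ne_zero hγ.ne' (hd d))).1 h).const_mul γ
    rw [mul_one] at h1
    refine h1.congr fun d ↦ ?_
    have := hd d
    simp only [Pi.div_apply]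
    field_simp
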